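/- Let $E$ be a metric space in which closed bounded sets are compact (so $E$ is locally compact, complete and separable), and let $\mu$ be a $\sigma$-finite Borel measure on $E$. A configuration on $E$ is a collection of points of $E$ (without regard to order) of which only finitely many lie in any bounded set; $\mathrm{Conf}(E)$ is the space of configurations with the $\sigma$-algebra generated by the numbers of points in bounded Borel sets. An operator $K$ on $L_2(E,\mu)$ is locally of trace class if $\chi_BK\chi_B$ is of trace class for every bounded Borel set $B$. A Borel probability measure $\mathbb P$ on $\mathrm{Conf}(E)$ is the determinantal measure $\mathbb P_K$ induced by such a $K$ if $$\int \prod_{x\in X}h(x)\,d\mathbb P(X)=\det\bigl(1+(h-1)K\chi_B\bigr)$$ (with integrable integrand) for every bounded Borel set $B$ and every bounded measurable $h:E\to\mathbb C$ with $h=1$ outside $B$. Let $\mathcal M_{\mathrm{fin}}(E)$ be the space of finite Borel measures on $E$ with the weak topology, and $\mathcal M_{\mathrm{fin}}(\mathcal M_{\mathrm{fin}}(E))$ the space of finite Borel measures on $\mathcal M_{\mathrm{fin}}(E)$, again with the weak topology. For $f:E\to[0,\infty)$ put $\mathrm{Conf}_f(E)=\{X:\sum_{x\in X}f(x)<\infty\}$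 and $\sigma_f(X)=\sum_{x\in X}f(x)\delta_x\in\mathcal M_{\mathrm{fin}}(E)$ for $X\in\mathrm{Conf}_f(E)$. **Proposition 3.8.** Let $f:E\to[0,\infty)$ be bounded and continuous, let $g:E\to[0,1]$ be Borel, and let $(\Pi_\alpha)$ be a family of locally trace class orthogonal projections in $L_2(E,\mu)$, with ranges $L_\alpha$, such that 1. $\sup_\alpha \operatorname{tr}\sqrt f\,\Pi_\alpha\sqrt f<\infty$, and for every $\varepsilon>0$ there is a bounded Borel set $B_\varepsilon\subset E$ with $\sup_\alpha\operatorname{tr}\chi_{E\setminus B_\varepsilon}\sqrt f\,\Pi_\alpha\sqrt f\,\chi_{E\setminus B_\varepsilon}<\varepsilon$; 2. for every $\alpha$ the operator $\sqrt{1-g}\,\Pi_\alpha\sqrt{1-g}$ is of trace class and $\|(1-g)\Pi_\alpha\|<1$; 3. $\inf_\alpha\bigl(1-\|(1-g)\Pi_\alpha\|\bigr)>0$. Then for every $\alpha$ the subspace $\sqrt g\,L_\alpha$ is closed and the orthogonal projection $\Pi_\alpha^g$ onto it is locally of trace class; and if $\mathbb P_{\Pi_\alpha^g}$ denotes the determinantal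 measure induced by $\Pi_\alpha^g$, then $\mathbb P_{\Pi_\alpha^g}(\mathrm{Conf}_f(E))=1$ for every $\alpha$, so that $(\sigma_f)_*\mathbb P_{\Pi_\alpha^g}$ is well defined, and the family $\{(\sigma_f)_*\mathbb P_{\Pi_\alpha^g}\}$ is weakly precompact, i.e. has compact closure, in $\mathcal M_{\mathrm{fin}}(\mathcal M_{\mathrm{fin}}(E))$. -/

import Mathlib

open MeasureTheory Filter Topology
open scoped ENNReal NNReal InnerProductSpace

noncomputable section

namespace DetProc

/-! ### The weak topology on the space of finite measures on the space of finite measures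

`FiniteMeasure E` carries in Mathlib the weak topology and the sigma-algebra generated by the
evaluations `η ↦ η A`.  For a separable metric space `E` the latter is the Borel sigma-algebra of
the weak topology; this is needed in order to speak of the weak topology on
`FiniteMeasure (FiniteMeasure E)`. -/

section Borel

variable {E : Type*} [MetricSpace E]

variable [TopologicalSpace.SeparableSpace E]

/-- Index set of a countable family of tent functions: centre, height, slope. -/
abbrev TentIndex (E : Type*) [MetricSpace E] [TopologicalSpace.SeparableSpace E] : Type _ :=
  (TopologicalSpace.exists_countable_dense E).choose × ℚ × ℕ

instance : Countable (TentIndex E) := by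
  have : Countable (TopologicalSpace.exists_countable_dense E).choose :=
    (TopologicalSpace.exists_countable_dense E).choose_spec.1.to_subtype
  infer_instance

/-- The tent function `x ↦ (q - m d(x, y))₊`. -/
def tent (i : TentIndex E) (x : E) : ℝ≥0 :=
  Real.toNNReal (i.2.1 : ℝ) - (i.2.2 : ℝ≥0) * nndist x i.1

lemma exists_tent {f : E → ℝ≥0} (hf : Continuous f) (x : E) (a : ℝ≥0) (ha : a < f x) :
    ∃ i, tent i ≤ f ∧ a < tent i x := by
  obtain ⟨q, hq1, hq2⟩ := exists_rat_btwn (show (a : ℝ) < f x by exact_mod_cast ha)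
  have hqpos : (0 : ℝ) < q := lt_of_le_of_lt a.coe_nonneg hq1
  have hnear : ∀ᶠ z in 𝓝 x, (q : ℝ) < f z := by
    have : Continuous fun z => ((f z : ℝ≥0) : ℝ) := by fun_prop
    exact this.continuousAt.eventually_const_lt hq2
  obtain ⟨r, hr, hball⟩ := Metric.eventually_nhds_iff.1 hnear
  obtain ⟨m, hm⟩ := exists_nat_gt ((q : ℝ) / (r / 2))
  have hr2 : (0 : ℝ) < r / 2 := by positivity
  have hm' : (q : ℝ) < m * (r / 2) := by rwa [div_lt_iff₀ hr2] at hm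
  have hmpos : (0 : ℝ) < m := lt_trans (by positivity) hm
  have hd := (TopologicalSpace.exists_countable_dense E).choose_spec.2
  obtain ⟨y, hyS, hy⟩ := hd.exists_dist_lt x
    (show (0 : ℝ) < min (r / 2) (((q : ℝ) - a) / m) from
      lt_min hr2 (div_pos (by linarith) hmpos))
  refine ⟨(⟨y, hyS⟩, q, m), ?_, ?_⟩
  · intro z
    change Real.toNNReal (q : ℝ) - (m : ℝ≥0) * nndist z y ≤ f z
    rw [tsub_le_iff_right, ← NNReal.coe_le_coe]
    push_cast
    rw [Real.coe_toNNReal _ hqpos.le]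
    by_cases hz : dist z x < r
    · have := hball hz
      have h0 : (0 : ℝ) ≤ m * dist z y := by positivity
      linarith
    · have h1 : dist z x ≤ dist z y + dist x y := by
        rw [dist_comm x y]; exact dist_triangle _ _ _
      have h2 : dist x y < r / 2 := lt_of_lt_of_le hy (min_le_left _ _)
      have h3 : r / 2 ≤ dist z y := by linarith [not_lt.1 hz]
      have h4 : (m : ℝ) * (r / 2) ≤ m * dist z y := by gcongr
      have h5 := (f z).coe_nonneg
      linarith
  · change a < Real.toNNReal (q : ℝ) - (m : ℝ≥0) * nndist x y
    rw [lt_tsub_iff_right, ← NNReal.coe_lt_coe]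
    push_cast
    rw [Real.coe_toNNReal _ hqpos.le]
    have h2 : dist x y < ((q : ℝ) - a) / m := lt_of_lt_of_le hy (min_le_right _ _)
    rw [lt_div_iff₀ hmpos] at h2
    linarith

/-- Finite suprema of tent functions. -/
def tentSup (t : Finset (TentIndex E)) (x : E) : ℝ≥0 := t.sup fun i => tent i x

variable [MeasurableSpace E] [BorelSpace E]

lemma measurable_tentSup (t : Finset (TentIndex E)) :
    Measurable fun x => ((tentSup t x : ℝ≥0) : ℝ≥0∞) := by
  have : Continuous fun x => tentSup t x := by
    unfold tentSup
    refine Continuous.finset_sup_apply fun i _ => ?_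
    unfold tent
    fun_prop
  exact this.measurable.coe_nnreal_ennreal

lemma lintegral_eq_iSup_tent {f : E → ℝ≥0} (hf : Continuous f) (η : Measure E) :
    ∫⁻ x, f x ∂η = ⨆ t : {t : Finset (TentIndex E) // tentSup t ≤ f}, ∫⁻ x, tentSup t.1 x ∂η := by
  classical
  rw [← lintegral_iSup_directed]
  · congr 1
    ext x
    apply le_antisymm
    · refine le_of_forall_lt fun c hc => ?_
      lift c to ℝ≥0 using (hc.trans ENNReal.coe_lt_top).ne
      obtain ⟨i, hi1, hi2⟩ := exists_tent hf x c (by exact_mod_cast hc)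
      refine lt_of_lt_of_le ?_ (le_iSup (fun t : {t : Finset (TentIndex E) // tentSup t ≤ f} =>
        ((tentSup t.1 x : ℝ≥0) : ℝ≥0∞)) ⟨{i}, fun y => by simpa [tentSup] using hi1 y⟩)
      simpa [tentSup] using hi2
    · exact iSup_le fun t => by exact_mod_cast t.2 x
  · exact fun t => (measurable_tentSup t.1).aemeasurable
  · intro s t
    refine ⟨⟨s.1 ∪ t.1, fun x => ?_⟩, fun x => ?_, fun x => ?_⟩
    · have h := sup_le (s.2 x) (t.2 x)
      simpa [tentSup, Finset.sup_union] using h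
    · have : tentSup s.1 x ≤ tentSup (s.1 ∪ t.1) x := Finset.sup_mono Finset.subset_union_left
      exact ENNReal.coe_le_coe.2 this
    · have : tentSup t.1 x ≤ tentSup (s.1 ∪ t.1) x := Finset.sup_mono Finset.subset_union_right
      exact ENNReal.coe_le_coe.2 this

/-- The total mass and the integrals of all finite suprema of tent functions. -/
def tentEval (η : FiniteMeasure E) (o : Option (Finset (TentIndex E))) : ℝ≥0∞ :=
  o.elim ((η : Measure E) Set.univ) fun t => ∫⁻ x, tentSup t x ∂(η : Measure E)

lemma measurable_tentEval : Measurable (tentEval (E := E)) := by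
  refine measurable_pi_lambda _ fun o => ?_
  cases o with
  | none => exact (Measure.measurable_coe MeasurableSet.univ).comp measurable_subtype_coe
  | some t =>
    exact (Measure.measurable_lintegral (measurable_tentSup t)).comp measurable_subtype_coe

lemma eventually_lt_lintegral {F : Filter (FiniteMeasure E)} {η : FiniteMeasure E}
    (hF : Tendsto tentEval F (𝓝 (tentEval η))) {f : E → ℝ≥0} (hf : Continuous f) {a : ℝ≥0∞}
    (ha : a < ∫⁻ x, f x ∂(η : Measure E)) : ∀ᶠ ν : FiniteMeasure E in F, a < ∫⁻ x, f x ∂(ν : Measure E) := by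
  rw [lintegral_eq_iSup_tent hf, lt_iSup_iff] at ha
  obtain ⟨t, ht⟩ := ha
  have := (tendsto_pi_nhds.1 hF (some t.1)).eventually_const_lt ht
  filter_upwards [this] with ν hν
  exact hν.trans_le (lintegral_mono fun x => ENNReal.coe_le_coe.2 (t.2 x))

lemma tendsto_of_tentEval {F : Filter (FiniteMeasure E)} {η : FiniteMeasure E}
    (hF : Tendsto tentEval F (𝓝 (tentEval η))) : Tendsto id F (𝓝 η) := by
  rw [FiniteMeasure.tendsto_iff_forall_lintegral_tendsto]
  intro f
  obtain ⟨c, hc⟩ : ∃ c : ℝ≥0, ∀ x, f x ≤ c :=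
    ⟨nndist f 0, fun x => by
      simpa using! BoundedContinuousFunction.nndist_coe_le_nndist (f := f) (g := 0) x⟩
  refine tendsto_order.2 ⟨fun a ha => eventually_lt_lintegral hF f.continuous ha, fun b hb => ?_⟩
  have key : ∀ ν : FiniteMeasure E, ∫⁻ x, f x ∂(ν : Measure E) +
      ∫⁻ x, ((c - f x : ℝ≥0) : ℝ≥0∞) ∂(ν : Measure E) = c * (ν : Measure E) Set.univ := by
    intro ν
    rw [← lintegral_add_left f.continuous.measurable.coe_nnreal_ennreal, ← lintegral_const]
    refine lintegral_congr fun x => ?_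
    rw [← ENNReal.coe_add, add_tsub_cancel_of_le (hc x)]
  have hmass : Tendsto (fun ν : FiniteMeasure E => (c : ℝ≥0∞) * (ν : Measure E) Set.univ) F
      (𝓝 (c * (η : Measure E) Set.univ)) :=
    ENNReal.Tendsto.const_mul (tendsto_pi_nhds.1 hF none) (Or.inr ENNReal.coe_ne_top)
  set J : FiniteMeasure E → ℝ≥0∞ := fun ν => ∫⁻ x, ((c - f x : ℝ≥0) : ℝ≥0∞) ∂(ν : Measure E)
    with hJ
  set I : FiniteMeasure E → ℝ≥0∞ := fun ν => ∫⁻ x, f x ∂(ν : Measure E) with hI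
  have hfin : ∀ ν : FiniteMeasure E, c * (ν : Measure E) Set.univ ≠ ⊤ := fun ν =>
    ENNReal.mul_ne_top ENNReal.coe_ne_top (measure_ne_top _ _)
  have hJfin : ∀ ν, J ν ≠ ⊤ := fun ν h => hfin ν (by
    rw [← key ν]; change I ν + J ν = ⊤; rw [h, add_top])
  have hIeq : ∀ ν, I ν = c * (ν : Measure E) Set.univ - J ν := fun ν =>
    ENNReal.eq_sub_of_add_eq (hJfin ν) (key ν)
  have hsub : ∀ a, a < J η → ∀ᶠ ν in F, a < J ν := fun a ha =>
    eventually_lt_lintegral hF (f := fun x => c - f x) (by fun_prop) ha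
  by_cases h0 : J η = 0
  · have : c * (η : Measure E) Set.univ < b := by
      have := hIeq η; rw [h0, tsub_zero] at this; rw [← this]; exact hb
    filter_upwards [hmass.eventually_lt_const this] with ν hν
    exact lt_of_le_of_lt ((hIeq ν).trans_le tsub_le_self) hν
  · have hbJ : c * (η : Measure E) Set.univ < b + J η := by
      rw [← key η]
      exact ENNReal.add_lt_add_right (hJfin η) hb
    have hcont : Tendsto (fun a => b + a) (𝓝 (J η)) (𝓝 (b + J η)) :=
      (continuous_const.add continuous_id).tendsto _
    have hev := hcont.eventually_const_lt hbJ
    have hne : (𝓝[<] (J η)).NeBot := nhdsLT_neBot_of_exists_lt ⟨0, pos_iff_ne_zero.2 h0⟩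
    obtain ⟨a, ha1, ha2⟩ := ((hev.filter_mono nhdsWithin_le_nhds).and
      (self_mem_nhdsWithin (a := J η) (s := Set.Iio (J η)))).exists
    filter_upwards [hmass.eventually_lt_const ha1, hsub a ha2] with ν h1 h2
    have h3 : I ν + J ν < b + J ν := by
      have := key ν
      calc I ν + J ν = c * (ν : Measure E) Set.univ := this
        _ < b + a := h1
        _ ≤ b + J ν := by gcongr
    exact lt_of_add_lt_add_right h3

instance : OpensMeasurableSpace (FiniteMeasure E) where
  borel_le := by
    refine MeasurableSpace.generateFrom_le fun U hU => ?_
    let τ : TopologicalSpace (FiniteMeasure E) := TopologicalSpace.induced tentEval inferInstance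
    have hle : τ ≤ FiniteMeasure.instTopologicalSpace := by
      rw [le_iff_nhds]
      intro η
      refine tendsto_of_tentEval ?_
      rw [nhds_induced]
      exact tendsto_comap
    obtain ⟨V, hV, rfl⟩ := isOpen_induced_iff.1 (hle U hU)
    exact measurable_tentEval hV.measurableSet

/-- The sigma-algebra generated by the evaluations is the Borel sigma-algebra of the weak
topology. -/
instance : BorelSpace (FiniteMeasure E) := by
  refine ⟨le_antisymm ?_ OpensMeasurableSpace.borel_le⟩
  have hcoe : Measurable[borel (FiniteMeasure E)]
      fun η : FiniteMeasure E => (η : Measure E) := by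
    let _ : MeasurableSpace (FiniteMeasure E) := borel (FiniteMeasure E)
    have : BorelSpace (FiniteMeasure E) := ⟨rfl⟩
    have hlin : ∀ φ : BoundedContinuousFunction E ℝ≥0,
        Measurable fun η : FiniteMeasure E => ∫⁻ x, φ x ∂(η : Measure E) := by
      intro φ
      have := (FiniteMeasure.continuous_testAgainstNN_eval φ).measurable.coe_nnreal_ennreal
      simpa only [FiniteMeasure.testAgainstNN_coe_eq] using this
    refine Measurable.measure_of_isPiSystem (S := {F : Set E | IsClosed F})
      (by rw [‹BorelSpace E›.measurable_eq, borel_eq_generateFrom_isClosed]) isPiSystem_isClosed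
      (fun F hF => ?_) ?_
    · exact measurable_of_tendsto_metrizable (fun n => hlin (IsClosed.apprSeq hF n))
        (tendsto_pi_nhds.2 fun η =>
          HasOuterApproxClosed.tendsto_lintegral_apprSeq hF (η : Measure E))
    · simpa using hlin 1
  exact hcoe.comap_le

end Borel

/-! ### Configurations -/

section Configurations

variable {E : Type*} [MetricSpace E]

/-- A configuration on `E`: a collection of points without regard to order (`mult x` is the number
of particles at `x`), of which only finitely many lie in any bounded set.  Equivalently, an
integer-valued Radon measure on `E`. -/
structure Conf (E : Type*) [MetricSpace E] where
  mult : E → ℕ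
  finite_inter : ∀ B : Set E, Bornology.IsBounded B → (B ∩ Function.support mult).Finite

/-- The number of particles of `X` in `B` (used for bounded `B`). -/
def count (X : Conf E) (B : Set E) : ℕ := ∑ᶠ x ∈ B, X.mult x

/-- The sigma-algebra on the space of configurations generated by the numbers of particles in
bounded Borel sets; it is the Borel sigma-algebra of the vague topology. -/
instance [MeasurableSpace E] : MeasurableSpace (Conf E) :=
  ⨆ (B : Set E) (_ : Bornology.IsBounded B ∧ MeasurableSet B),
    MeasurableSpace.comap (fun X => count X B) ⊤

/-- The multiplicative functional `Ψ_h(X) = ∏_{x ∈ X} h(x)`, used for functions `h` that are equal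
to `1` outside a bounded set, so that the product is finite. -/
def psi (h : E → ℂ) (X : Conf E) : ℂ := ∏ᶠ x, h x ^ X.mult x

/-- `Conf_f(E)`: the configurations with `∑_{x ∈ X} f(x) < ∞`, for nonnegative `f`. -/
def confF (f : E → ℝ) : Set (Conf E) :=
  {X | ∑' x, (X.mult x : ℝ≥0∞) * ENNReal.ofReal (f x) < ∞}

variable [MeasurableSpace E]

/-- The measure `∑_{x ∈ X} f(x) δ_x`, for nonnegative `f`. -/
def sigmaMeasure (f : E → ℝ) (X : Conf E) : Measure E :=
  Measure.sum fun x => ((X.mult x : ℝ≥0∞) * ENNReal.ofReal (f x)) • Measure.dirac x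

lemma isFiniteMeasure_sigmaMeasure {f : E → ℝ} {X : Conf E} (hX : X ∈ confF f) :
    IsFiniteMeasure (sigmaMeasure f X) := by
  constructor
  simpa [sigmaMeasure, Measure.sum_apply _ MeasurableSet.univ] using! hX

open Classical in
/-- The map `σ_f : Conf_f(E) → M_fin(E)`, `σ_f(X) = ∑_{x ∈ X} f(x) δ_x`; it is extended by the
zero measure outside of `Conf_f(E)`. -/
def sigma (f : E → ℝ) (X : Conf E) : FiniteMeasure E :=
  if hX : X ∈ confF f then ⟨sigmaMeasure f X, isFiniteMeasure_sigmaMeasure hX⟩ else 0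

/-- The push-forward `(σ_f)_* P`, a finite measure on the space of finite measures on `E`
(meaningful if `P` gives full measure to `Conf_f(E)`). -/
def pushSigma (f : E → ℝ) (P : Measure (Conf E)) [IsFiniteMeasure P] :
    FiniteMeasure (FiniteMeasure E) :=
  ⟨P.map (sigma f), inferInstance⟩

lemma measurable_count {B : Set E} (hB : Bornology.IsBounded B) (hBm : MeasurableSet B) :
    Measurable fun X : Conf E => count X B := by
  refine Measurable.of_comap_le ?_
  exact le_iSup₂_of_le (f := fun (B : Set E) (_ : Bornology.IsBounded B ∧ MeasurableSet B) =>
    MeasurableSpace.comap (fun X : Conf E => count X B) ⊤) B ⟨hB, hBm⟩ le_rfl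

lemma sigmaMeasure_one_apply (X : Conf E) {B : Set E} (hB : Bornology.IsBounded B)
    (hBm : MeasurableSet B) : sigmaMeasure (fun _ => 1) X B = count X B := by
  have h1 : sigmaMeasure (fun _ => 1) X B = ∑' x, B.indicator (fun x => (X.mult x : ℝ≥0∞)) x := by
    rw [sigmaMeasure, Measure.sum_apply _ hBm]
    refine tsum_congr fun x => ?_
    by_cases hx : x ∈ B <;> simp [hx, hBm]
  have hfin := X.finite_inter B hB
  rw [h1, tsum_eq_sum (s := hfin.toFinset), count, finsum_mem_eq_sum _ hfin, Nat.cast_sum]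
  · refine Finset.sum_congr rfl fun x hx => ?_
    rw [Set.indicator_of_mem]
    simp at hx
    exact hx.1
  · intro x hx
    by_contra h
    apply hx
    simp only [Set.indicator_apply_ne_zero, Set.mem_inter_iff, Function.mem_support] at h
    simp only [Set.Finite.mem_toFinset, Set.mem_inter_iff, Function.mem_support]
    exact ⟨h.1, by exact_mod_cast h.2⟩

lemma measurable_sigmaMeasure_one [BorelSpace E] :
    Measurable fun X : Conf E => sigmaMeasure (fun _ => 1) X := by
  refine Measure.measurable_of_measurable_coe _ fun A hA => ?_
  rcases isEmpty_or_nonempty E with hE | ⟨⟨x₀⟩⟩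
  · have : A = ∅ := Set.eq_empty_of_isEmpty A
    simp [this]
  · have h : ∀ X : Conf E, sigmaMeasure (fun _ => 1) X A =
        ⨆ n : ℕ, (count X (A ∩ Metric.closedBall x₀ n) : ℝ≥0∞) := by
      intro X
      have hmono : Monotone fun n : ℕ => A ∩ Metric.closedBall x₀ (n : ℝ) := by
        intro n m hnm
        exact Set.inter_subset_inter_right _
          (Metric.closedBall_subset_closedBall (by exact_mod_cast hnm))
      have hU : A = ⋃ n : ℕ, A ∩ Metric.closedBall x₀ (n : ℝ) := by
        rw [← Set.inter_iUnion, Metric.iUnion_closedBall_nat, Set.inter_univ]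
      conv_lhs => rw [hU]
      rw [hmono.measure_iUnion]
      refine iSup_congr fun n => ?_
      exact sigmaMeasure_one_apply X (Metric.isBounded_closedBall.subset Set.inter_subset_right)
        (hA.inter Metric.isClosed_closedBall.measurableSet)
    simp_rw [h]
    refine Measurable.iSup fun n => ?_
    exact (measurable_from_top (f := fun k : ℕ => (k : ℝ≥0∞))).comp
      (measurable_count (Metric.isBounded_closedBall.subset Set.inter_subset_right)
        (hA.inter Metric.isClosed_closedBall.measurableSet))

lemma lintegral_sigmaMeasure_one (X : Conf E) {F : E → ℝ≥0∞} (hF : Measurable F) :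
    ∫⁻ x, F x ∂(sigmaMeasure (fun _ => 1) X) = ∑' x, (X.mult x : ℝ≥0∞) * F x := by
  rw [sigmaMeasure, lintegral_sum_measure]
  refine tsum_congr fun x => ?_
  rw [lintegral_smul_measure, lintegral_dirac' x hF]
  simp

/-- `σ_f` is measurable, so that the push-forward under `σ_f` is the genuine one. -/
lemma measurable_sigma [BorelSpace E] {f : E → ℝ} (hf : Measurable f) : Measurable (sigma f) := by
  classical
  have hf' : Measurable fun x => ENNReal.ofReal (f x) := hf.ennreal_ofReal
  have hint : ∀ F : E → ℝ≥0∞, Measurable F →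
      Measurable fun X : Conf E => ∑' x, (X.mult x : ℝ≥0∞) * F x := by
    intro F hF
    have := (Measure.measurable_lintegral hF).comp (measurable_sigmaMeasure_one (E := E))
    simpa only [Function.comp_def, lintegral_sigmaMeasure_one _ hF] using this
  have hset : MeasurableSet (confF f) := measurableSet_lt (hint _ hf') measurable_const
  have hmeas : Measurable fun X : Conf E => sigmaMeasure f X := by
    refine Measure.measurable_of_measurable_coe _ fun A hA => ?_
    have h := hint (A.indicator fun x => ENNReal.ofReal (f x)) (hf'.indicator hA)
    have heq : ∀ X : Conf E, sigmaMeasure f X A =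
        ∑' x, (X.mult x : ℝ≥0∞) * A.indicator (fun x => ENNReal.ofReal (f x)) x := by
      intro X
      rw [sigmaMeasure, Measure.sum_apply _ hA]
      refine tsum_congr fun x => ?_
      by_cases hx : x ∈ A <;> simp [hx, hA]
    simpa only [heq] using h
  refine Measurable.subtype_mk (f := fun X => ((sigma f X : FiniteMeasure E) : Measure E)) ?_
  have : (fun X => ((sigma f X : FiniteMeasure E) : Measure E)) =
      fun X => if X ∈ confF f then sigmaMeasure f X else 0 := by
    ext1 X
    by_cases hX : X ∈ confF f
    · simp [sigma, hX]
    · simp [sigma, hX]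
  rw [this]
  exact Measurable.ite hset hmeas measurable_const

end Configurations

/-! ### Trace class operators and Fredholm determinants -/

section Operators

variable {H : Type*} [NormedAddCommGroup H] [InnerProductSpace ℂ H]

lemma tsum_inner_sq {κ : Type*} (b : HilbertBasis κ ℂ H) (x : H) :
    ∑' k, ENNReal.ofReal (‖⟪b k, x⟫_ℂ‖ ^ 2) = ENNReal.ofReal (‖x‖ ^ 2) := by
  have h := (b.hasSum_inner_mul_inner x x).mapL (RCLike.reCLM (K := ℂ))
  have h2 : ∀ k, RCLike.reCLM (K := ℂ) (⟪x, b k⟫_ℂ * ⟪b k, x⟫_ℂ) = ‖⟪b k, x⟫_ℂ‖ ^ 2 := by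
    intro k
    rw [← inner_conj_symm x (b k), RCLike.conj_mul]
    norm_cast
  simp_rw [h2] at h
  rw [← ENNReal.ofReal_tsum_of_nonneg (fun k => by positivity) h.summable, h.tsum_eq]
  congr 1
  exact inner_self_eq_norm_sq (𝕜 := ℂ) x

variable [CompleteSpace H]

/-- The trace `∑_e ⟨e, A e⟩ ∈ [0, ∞]` of a positive operator `A`, the sum being over an orthonormal
basis of the Hilbert space. -/
def posTrace (A : H →L[ℂ] H) : ℝ≥0∞ :=
  ∑' e : (exists_hilbertBasis ℂ H).choose, ENNReal.ofReal (RCLike.re ⟪(e : H), A e⟫_ℂ)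

lemma tsum_inner_eq {A : H →L[ℂ] H} (hA : 0 ≤ A) {κ κ' : Type*} (b : HilbertBasis κ ℂ H)
    (b' : HilbertBasis κ' ℂ H) :
    ∑' k, ENNReal.ofReal (RCLike.re ⟪b k, A (b k)⟫_ℂ) =
      ∑' k, ENNReal.ofReal (RCLike.re ⟪b' k, A (b' k)⟫_ℂ) := by
  set S := CFC.sqrt A with hS
  have hSS : S * S = A := CFC.sqrt_mul_sqrt_self A hA
  have hSsym : ∀ x y : H, ⟪S x, y⟫_ℂ = ⟪x, S y⟫_ℂ :=
    ((ContinuousLinearMap.nonneg_iff_isPositive S).1 (CFC.sqrt_nonneg A)).isSymmetric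
  have hx : ∀ x : H, RCLike.re ⟪x, A x⟫_ℂ = ‖S x‖ ^ 2 := by
    intro x
    rw [← hSS]
    change RCLike.re ⟪x, S (S x)⟫_ℂ = _
    rw [← hSsym]
    exact inner_self_eq_norm_sq (𝕜 := ℂ) (S x)
  simp_rw [hx]
  calc ∑' k, ENNReal.ofReal (‖S (b k)‖ ^ 2)
      = ∑' k, ∑' l, ENNReal.ofReal (‖⟪b' l, S (b k)⟫_ℂ‖ ^ 2) := by simp_rw [tsum_inner_sq b']
    _ = ∑' l, ∑' k, ENNReal.ofReal (‖⟪b' l, S (b k)⟫_ℂ‖ ^ 2) := ENNReal.tsum_comm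
    _ = ∑' l, ∑' k, ENNReal.ofReal (‖⟪b k, S (b' l)⟫_ℂ‖ ^ 2) := by
        refine tsum_congr fun l => tsum_congr fun k => ?_
        rw [← hSsym, ← inner_conj_symm, RCLike.norm_conj]
    _ = _ := by simp_rw [tsum_inner_sq b]

/-- The trace of a positive operator can be computed in every orthonormal basis. -/
lemma posTrace_eq {A : H →L[ℂ] H} (hA : 0 ≤ A) {κ : Type*} (b : HilbertBasis κ ℂ H) :
    posTrace A = ∑' k, ENNReal.ofReal (RCLike.re ⟪b k, A (b k)⟫_ℂ) := by
  obtain ⟨b₀, hb₀⟩ := (exists_hilbertBasis ℂ H).choose_spec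
  rw [← tsum_inner_eq hA b₀ b, posTrace]
  simp only [hb₀]

/-- `A` is of trace class: `tr |A| < ∞`. -/
def IsTraceClass (A : H →L[ℂ] H) : Prop := posTrace (CFC.abs A) < ∞

/-- The compression of `A` to the linear span of a finite set of vectors. -/
def compress (A : H →L[ℂ] H) (s : Finset H) :
    Submodule.span ℂ (s : Set H) →L[ℂ] Submodule.span ℂ (s : Set H) :=
  (Submodule.span ℂ (s : Set H)).orthogonalProjectionOnto ∘L A ∘L
    (Submodule.span ℂ (s : Set H)).subtypeL

/-- `d` is the Fredholm determinant `det(1 + A)`: the limit of the determinants of `1 + A_F`, where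
`A_F` is the compression of `A` to a finite-dimensional subspace `F`, and `F` increases to the whole
space.  For trace class `A` the limit exists, since then the compressions converge to `A` in trace
norm and the determinant is continuous in trace norm. -/
def HasFredholmDet (A : H →L[ℂ] H) (d : ℂ) : Prop :=
  Tendsto (fun s : Finset H => (1 + compress A s).det) atTop (𝓝 d)

end Operators

section L2

variable {E : Type*} [MetricSpace E] [MeasurableSpace E]

/-- The operator on `L_2(E, μ)` of multiplication by a bounded measurable function `h`. -/
def mulOp (μ : Measure E) (h : E → ℂ) : Lp ℂ 2 μ →L[ℂ] Lp ℂ 2 μ :=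
  open Classical in
  if hh : MemLp h ∞ μ then (ContinuousLinearMap.mul ℂ ℂ).holderL μ ∞ 2 2 (hh.toLp h) else 0

/-- The operator `√w K √w` for a bounded nonnegative measurable function `w`. -/
def sandwich (μ : Measure E) (w : E → ℝ) (K : Lp ℂ 2 μ →L[ℂ] Lp ℂ 2 μ) :
    Lp ℂ 2 μ →L[ℂ] Lp ℂ 2 μ :=
  mulOp μ (fun x => (√(w x) : ℂ)) ∘L K ∘L mulOp μ (fun x => (√(w x) : ℂ))

/-- The operator `χ_B K χ_B`. -/
def cutoff (μ : Measure E) (B : Set E) (K : Lp ℂ 2 μ →L[ℂ] Lp ℂ 2 μ) :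
    Lp ℂ 2 μ →L[ℂ] Lp ℂ 2 μ :=
  mulOp μ (B.indicator 1) ∘L K ∘L mulOp μ (B.indicator 1)

/-- `K` is locally of trace class: `χ_B K χ_B` is of trace class for every bounded Borel `B`. -/
def IsLocTraceClass (μ : Measure E) (K : Lp ℂ 2 μ →L[ℂ] Lp ℂ 2 μ) : Prop :=
  ∀ B : Set E, Bornology.IsBounded B → MeasurableSet B → IsTraceClass (cutoff μ B K)

/-- `P` is the determinantal measure `P_K` on the space of configurations: for every bounded
measurable `h` with `h - 1` supported in a bounded Borel set `B` one has
`E_P Ψ_h = det(1 + (h - 1) K χ_B)`.  Used for locally trace class `K`. -/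
def IsDeterminantal (μ : Measure E) (K : Lp ℂ 2 μ →L[ℂ] Lp ℂ 2 μ) (P : Measure (Conf E)) : Prop :=
  ∀ (h : E → ℂ) (B : Set E), Measurable h → (∃ C : ℝ, ∀ x, ‖h x‖ ≤ C) →
    Bornology.IsBounded B → MeasurableSet B → (∀ x ∉ B, h x = 1) →
    Integrable (psi h) P ∧
      HasFredholmDet (mulOp μ (fun x => h x - 1) ∘L K ∘L mulOp μ (B.indicator 1))
        (∫ X, psi h X ∂P)

/-- The subspace `√g L`, where `L` is the range of the projection `Q`. -/
def inducedSpace (μ : Measure E) (g : E → ℝ) (Q : Lp ℂ 2 μ →L[ℂ] Lp ℂ 2 μ) :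
    Submodule ℂ (Lp ℂ 2 μ) :=
  Submodule.map (mulOp μ (fun x => (√(g x) : ℂ))).toLinearMap Q.range

/-- The operator `Q^g` of orthogonal projection onto (the closure of) the subspace `√g L`, where
`L` is the range of the projection `Q`. -/
def inducedProj (μ : Measure E) (g : E → ℝ) (Q : Lp ℂ 2 μ →L[ℂ] Lp ℂ 2 μ) :
    Lp ℂ 2 μ →L[ℂ] Lp ℂ 2 μ :=
  (inducedSpace μ g Q).topologicalClosure.starProjection

end L2

end DetProc

end

/-! Everything is controlled by first moments. For a projection Q and an orthonormal basis b, the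
measure `traceMeasure` with μ-density ∑ₖ |Q bₖ|² satisfies tr √w Q √w = ∫ w d(`traceMeasure`), so
the trace hypotheses become statements about integrals.

Write L for the range of Q. Since ‖(1-g)Q‖ ≤ 1-δ, multiplication by √g is bounded below by √δ on L.
Hence √g L is closed, and duality gives the operator inequality δ Q^g ≤ √g Q √g
(`mul_norm_inducedProj_sq_le`). As g ≤ 1, the intensity of Q^g is at most δ⁻¹ times that of Q
(`traceMeasure_inducedProj_le`), uniformly in α. Local trace class follows.

On the probabilistic side, h = 1 + tχ_B turns the defining identity into E(1+t)^{#B} = det(1 + tχ_B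
K χ_B) ≤ exp(t tr χ_B K χ_B), and t → 0 bounds the mean of #B by the trace (`lintegral_count_le`).
Hence E ∑ F(x) ≤ ∫ F d(`traceMeasure`) for every measurable F ≥ 0 (`lintegral_tsum_mult_le`). With F
= f this shows that Conf_f has full measure.

For precompactness, take F = f·w with w growing so slowly at infinity that the means stay bounded in
α. The sets of finite measures η with prescribed bounds on mass and tails are compact, and a bound
on ∫ w dη puts η in such a set. Markov's inequality then makes the laws of σ_f uniformly tight on
the space of measures, and the same compactness criterion applies one level up. -/

set_option linter.unusedSectionVars false

noncomputable section

namespace DetProc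

/-! ### Hilbert-Schmidt sums and traces of T*T -/

section HilbertSchmidt

variable {H : Type*} [NormedAddCommGroup H] [InnerProductSpace ℂ H] [CompleteSpace H]

lemma tsum_enorm_inner_sq {κ : Type*} (b : HilbertBasis κ ℂ H) (x : H) :
    ∑' k, ‖⟪b k, x⟫_ℂ‖ₑ ^ 2 = ‖x‖ₑ ^ 2 := by
  have h := tsum_inner_sq b x
  simpa [ENNReal.ofReal_pow] using h

/-- The Hilbert-Schmidt norms of an operator and of its adjoint agree. -/
lemma tsum_enorm_sq_adjoint {κ : Type*} (b : HilbertBasis κ ℂ H) (T : H →L[ℂ] H) :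
    ∑' k, ‖T (b k)‖ₑ ^ 2 = ∑' k, ‖T.adjoint (b k)‖ₑ ^ 2 := by
  calc ∑' k, ‖T (b k)‖ₑ ^ 2 = ∑' k, ∑' l, ‖⟪b l, T (b k)⟫_ℂ‖ₑ ^ 2 := by
        simp_rw [tsum_enorm_inner_sq b]
    _ = ∑' l, ∑' k, ‖⟪b l, T (b k)⟫_ℂ‖ₑ ^ 2 := ENNReal.tsum_comm
    _ = ∑' l, ∑' k, ‖⟪b k, T.adjoint (b l)⟫_ℂ‖ₑ ^ 2 := by
        refine tsum_congr fun l => tsum_congr fun k => ?_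
        rw [ContinuousLinearMap.adjoint_inner_right, ← inner_conj_symm, RCLike.enorm_conj]
    _ = _ := by simp_rw [tsum_enorm_inner_sq b]

lemma posTrace_adjoint_comp_self {κ : Type*} (b : HilbertBasis κ ℂ H) (T : H →L[ℂ] H) :
    posTrace (T.adjoint ∘L T) = ∑' k, ‖T (b k)‖ₑ ^ 2 := by
  have h0 : 0 ≤ T.adjoint ∘L T :=
    (ContinuousLinearMap.nonneg_iff_isPositive _).2 T.isPositive_adjoint_comp_self
  rw [posTrace_eq h0 b]
  refine tsum_congr fun k => ?_
  rw [ContinuousLinearMap.comp_apply, ContinuousLinearMap.adjoint_inner_right,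
    inner_self_eq_norm_sq, ENNReal.ofReal_pow (norm_nonneg _), ofReal_norm]

lemma isTraceClass_iff_of_nonneg {A : H →L[ℂ] H} (hA : 0 ≤ A) :
    IsTraceClass A ↔ posTrace A < ∞ := by
  rw [IsTraceClass, CFC.abs_of_nonneg A hA]

end HilbertSchmidt

/-! ### Multiplication operators and the intensity measure of a projection -/

section Multiplication

variable {E : Type*} [MetricSpace E] [MeasurableSpace E] {μ : Measure E}

lemma mulOp_coeFn {h : E → ℂ} (hm : Measurable h) (hb : ∃ C : ℝ, ∀ x, ‖h x‖ ≤ C)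
    (u : Lp ℂ 2 μ) : mulOp μ h u =ᵐ[μ] fun x => h x * u x := by
  obtain ⟨C, hC⟩ := hb
  have hh : MemLp h ∞ μ := memLp_top_of_bound hm.aestronglyMeasurable C (ae_of_all _ hC)
  rw [mulOp, dif_pos hh]
  have h1 := ContinuousLinearMap.coeFn_holder (p := ∞) (q := 2) (r := 2)
    (B := ContinuousLinearMap.mul ℂ ℂ) (f := hh.toLp h) (g := u)
  filter_upwards [h1, hh.coeFn_toLp] with x hx hx2
  rw [ContinuousLinearMap.holderL_apply_apply, hx, hx2]
  simp

lemma mulOp_comp_mulOp {h k : E → ℂ} (hm : Measurable h) (hb : ∃ C : ℝ, ∀ x, ‖h x‖ ≤ C)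
    (km : Measurable k) (kb : ∃ C : ℝ, ∀ x, ‖k x‖ ≤ C) :
    mulOp μ h ∘L mulOp μ k = mulOp μ (fun x => h x * k x) := by
  ext1 u
  apply Lp.ext
  have hkb : ∃ C : ℝ, ∀ x, ‖h x * k x‖ ≤ C := by
    obtain ⟨C, hC⟩ := hb
    obtain ⟨D, hD⟩ := kb
    refine ⟨C * D, fun x => ?_⟩
    rw [norm_mul]
    exact mul_le_mul (hC x) (hD x) (norm_nonneg _) ((norm_nonneg _).trans (hC x))
  filter_upwards [mulOp_coeFn hm hb (mulOp μ k u), mulOp_coeFn km kb u,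
    mulOp_coeFn (h := fun x => h x * k x) (hm.mul km) hkb u] with x h1 h2 h3
  rw [ContinuousLinearMap.comp_apply, h1, h2, h3, mul_assoc]

lemma mulOp_const_mul {h : E → ℂ} (hm : Measurable h) (hb : ∃ C : ℝ, ∀ x, ‖h x‖ ≤ C) (c : ℂ) :
    mulOp μ (fun x => c * h x) = c • mulOp μ h := by
  ext1 u
  apply Lp.ext
  have hcb : ∃ C : ℝ, ∀ x, ‖c * h x‖ ≤ C := by
    obtain ⟨C, hC⟩ := hb
    exact ⟨‖c‖ * C, fun x => by rw [norm_mul]; gcongr; exact hC x⟩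
  filter_upwards [mulOp_coeFn hm hb u, mulOp_coeFn (hm.const_mul c) hcb u,
    Lp.coeFn_smul c (mulOp μ h u)] with x h1 h2 h3
  rw [h2, _root_.smul_apply, h3, Pi.smul_apply, h1, smul_eq_mul, mul_assoc]

lemma mulOp_adjoint {h : E → ℝ} (hm : Measurable h) (hb : ∃ C : ℝ, ∀ x, |h x| ≤ C) :
    (mulOp μ (fun x => (h x : ℂ))).adjoint = mulOp μ (fun x => (h x : ℂ)) := by
  have hm' : Measurable fun x => (h x : ℂ) := by fun_prop
  have hb' : ∃ C : ℝ, ∀ x, ‖(h x : ℂ)‖ ≤ C := by simpa using hb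
  refine ((ContinuousLinearMap.eq_adjoint_iff _ _).2 fun u v => ?_).symm
  rw [L2.inner_def, L2.inner_def]
  refine integral_congr_ae ?_
  filter_upwards [mulOp_coeFn hm' hb' u, mulOp_coeFn hm' hb' v] with x h1 h2
  rw [h1, h2]
  simp only [RCLike.inner_apply, map_mul, Complex.conj_ofReal]
  ring

lemma enorm_mulOp_sq {h : E → ℂ} (hm : Measurable h) (hb : ∃ C : ℝ, ∀ x, ‖h x‖ ≤ C)
    (u : Lp ℂ 2 μ) : ‖mulOp μ h u‖ₑ ^ 2 = ∫⁻ x, ‖h x‖ₑ ^ 2 * ‖u x‖ₑ ^ 2 ∂μ := by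
  have h1 := eLpNorm_nnreal_pow_eq_lintegral (μ := μ) (f := mulOp μ h u) (p := 2) (by norm_num)
  rw [Lp.enorm_def]
  simp only [NNReal.coe_ofNat, ENNReal.rpow_ofNat, ENNReal.coe_ofNat] at h1
  rw [h1]
  refine lintegral_congr_ae ?_
  filter_upwards [mulOp_coeFn hm hb u] with x hx
  rw [hx, enorm_mul, mul_pow]

variable (μ) in
/-- The intensity measure `A ↦ tr χ_A Q χ_A` of a projection `Q`. -/
def traceMeasure {κ : Type*} (b : HilbertBasis κ ℂ (Lp ℂ 2 μ)) (Q : Lp ℂ 2 μ →L[ℂ] Lp ℂ 2 μ) :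
    Measure E :=
  Measure.sum fun k => μ.withDensity fun x => ‖Q (b k) x‖ₑ ^ 2

lemma measurable_enorm_sq (u : Lp ℂ 2 μ) : Measurable fun x => ‖u x‖ₑ ^ 2 :=
  (Lp.stronglyMeasurable u).measurable.enorm.pow_const 2

lemma lintegral_traceMeasure {κ : Type*} (b : HilbertBasis κ ℂ (Lp ℂ 2 μ))
    (Q : Lp ℂ 2 μ →L[ℂ] Lp ℂ 2 μ) {w : E → ℝ≥0∞} (hw : Measurable w) :
    ∫⁻ x, w x ∂(traceMeasure μ b Q) = ∑' k, ∫⁻ x, w x * ‖Q (b k) x‖ₑ ^ 2 ∂μ := by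
  rw [traceMeasure, lintegral_sum_measure]
  refine tsum_congr fun k => ?_
  rw [lintegral_withDensity_eq_lintegral_mul _ (measurable_enorm_sq _) hw]
  simp [mul_comm]

variable {w : E → ℝ}

lemma sqrt_bound (hwb : ∃ C, ∀ x, w x ≤ C) : ∃ C : ℝ, ∀ x, |√(w x)| ≤ C := by
  obtain ⟨C, hC⟩ := hwb
  exact ⟨√C, fun x => by rw [abs_of_nonneg (Real.sqrt_nonneg _)]; exact Real.sqrt_le_sqrt (hC x)⟩

lemma ofReal_bound {h : E → ℝ} (hb : ∃ C : ℝ, ∀ x, |h x| ≤ C) :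
    ∃ C : ℝ, ∀ x, ‖(h x : ℂ)‖ ≤ C := by simpa using hb

lemma enorm_sqrt_sq {r : ℝ} (hr : 0 ≤ r) : ‖((√r : ℝ) : ℂ)‖ₑ ^ 2 = ENNReal.ofReal r := by
  rw [← ofReal_norm, ← ENNReal.ofReal_pow (norm_nonneg _), Complex.norm_real, Real.norm_eq_abs,
    sq_abs, Real.sq_sqrt hr]

/-- Passing to the adjoint replaces Q√w by √w Q without changing the Hilbert-Schmidt sum; the new
sum is an integral of w against the densities |Q bₖ|². -/
lemma tsum_enorm_comp_mulOp {κ : Type*} (b : HilbertBasis κ ℂ (Lp ℂ 2 μ))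
    {Q : Lp ℂ 2 μ →L[ℂ] Lp ℂ 2 μ} (hQ : IsStarProjection Q) (hw : Measurable w)
    (hw0 : ∀ x, 0 ≤ w x) (hwb : ∃ C, ∀ x, w x ≤ C) :
    ∑' k, ‖Q (mulOp μ (fun x => (√(w x) : ℂ)) (b k))‖ₑ ^ 2 =
      ∫⁻ x, ENNReal.ofReal (w x) ∂(traceMeasure μ b Q) := by
  have hb := sqrt_bound hwb
  have h1 := tsum_enorm_sq_adjoint b (Q ∘L mulOp μ (fun x => (√(w x) : ℂ)))
  rw [ContinuousLinearMap.adjoint_comp, mulOp_adjoint hw.sqrt hb,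
    ← ContinuousLinearMap.star_eq_adjoint, hQ.isSelfAdjoint.star_eq] at h1
  simp only [ContinuousLinearMap.comp_apply] at h1
  rw [h1, lintegral_traceMeasure b Q hw.ennreal_ofReal]
  refine tsum_congr fun k => ?_
  rw [enorm_mulOp_sq (by fun_prop) (ofReal_bound hb)]
  simp_rw [enorm_sqrt_sq (hw0 _)]

/-- Because Q = Q² = Q*, the sandwich is T*T with T = Q√w. This yields both its positivity and its
trace as a Hilbert-Schmidt sum. -/
lemma sandwich_eq_adjoint_comp {Q : Lp ℂ 2 μ →L[ℂ] Lp ℂ 2 μ} (hQ : IsStarProjection Q)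
    (hw : Measurable w) (hwb : ∃ C, ∀ x, w x ≤ C) :
    sandwich μ w Q = (Q ∘L mulOp μ (fun x => (√(w x) : ℂ))).adjoint ∘L
      (Q ∘L mulOp μ (fun x => (√(w x) : ℂ))) := by
  rw [ContinuousLinearMap.adjoint_comp, mulOp_adjoint hw.sqrt (sqrt_bound hwb),
    ← ContinuousLinearMap.star_eq_adjoint, hQ.isSelfAdjoint.star_eq, sandwich]
  have h : Q ∘L Q = Q := hQ.isIdempotentElem
  conv_lhs => rw [← h]
  rfl

lemma sandwich_nonneg {Q : Lp ℂ 2 μ →L[ℂ] Lp ℂ 2 μ} (hQ : IsStarProjection Q)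
    (hw : Measurable w) (hwb : ∃ C, ∀ x, w x ≤ C) : 0 ≤ sandwich μ w Q := by
  rw [sandwich_eq_adjoint_comp hQ hw hwb]
  exact (ContinuousLinearMap.nonneg_iff_isPositive _).2
    (ContinuousLinearMap.isPositive_adjoint_comp_self _)

lemma posTrace_sandwich {κ : Type*} (b : HilbertBasis κ ℂ (Lp ℂ 2 μ))
    {Q : Lp ℂ 2 μ →L[ℂ] Lp ℂ 2 μ} (hQ : IsStarProjection Q) (hw : Measurable w)
    (hw0 : ∀ x, 0 ≤ w x) (hwb : ∃ C, ∀ x, w x ≤ C) :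
    posTrace (sandwich μ w Q) = ∫⁻ x, ENNReal.ofReal (w x) ∂(traceMeasure μ b Q) := by
  rw [sandwich_eq_adjoint_comp hQ hw hwb, posTrace_adjoint_comp_self b]
  exact tsum_enorm_comp_mulOp b hQ hw hw0 hwb

lemma indicator_one_eq_sqrt (B : Set E) :
    (B.indicator 1 : E → ℂ) = fun x => ((√(B.indicator 1 x : ℝ) : ℝ) : ℂ) := by
  ext x
  by_cases hx : x ∈ B <;> simp [hx]

lemma cutoff_eq_sandwich (B : Set E) (K : Lp ℂ 2 μ →L[ℂ] Lp ℂ 2 μ) :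
    cutoff μ B K = sandwich μ (B.indicator 1) K := by
  rw [cutoff, sandwich, indicator_one_eq_sqrt]

lemma indicator_nonneg' (B : Set E) (x : E) : (0 : ℝ) ≤ B.indicator 1 x :=
  Set.indicator_nonneg (fun _ _ => zero_le_one) x

lemma indicator_le_one' (B : Set E) : ∃ C : ℝ, ∀ x, (B.indicator 1 x : ℝ) ≤ C :=
  ⟨1, fun x => Set.indicator_le_self' (fun _ _ => zero_le_one) x⟩

lemma posTrace_cutoff {κ : Type*} (b : HilbertBasis κ ℂ (Lp ℂ 2 μ))
    {Q : Lp ℂ 2 μ →L[ℂ] Lp ℂ 2 μ} (hQ : IsStarProjection Q) {B : Set E} (hB : MeasurableSet B) :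
    posTrace (cutoff μ B Q) = traceMeasure μ b Q B := by
  rw [cutoff_eq_sandwich, posTrace_sandwich b hQ (measurable_one.indicator hB)
    (indicator_nonneg' B) (indicator_le_one' B), ← lintegral_indicator_one hB]
  refine lintegral_congr fun x => ?_
  by_cases hx : x ∈ B <;> simp [hx]

lemma cutoff_nonneg {Q : Lp ℂ 2 μ →L[ℂ] Lp ℂ 2 μ} (hQ : IsStarProjection Q) {B : Set E}
    (hB : MeasurableSet B) : 0 ≤ cutoff μ B Q := by
  rw [cutoff_eq_sandwich]
  exact sandwich_nonneg hQ (measurable_one.indicator hB) (indicator_le_one' B)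

/-- Multiplication operators commute and √χ_B √w = √(χ_B w), so cutting off a sandwich gives the
sandwich with weight χ_B w. -/
lemma posTrace_cutoff_sandwich {κ : Type*} (b : HilbertBasis κ ℂ (Lp ℂ 2 μ))
    {Q : Lp ℂ 2 μ →L[ℂ] Lp ℂ 2 μ} (hQ : IsStarProjection Q) (hw : Measurable w)
    (hw0 : ∀ x, 0 ≤ w x) (hwb : ∃ C, ∀ x, w x ≤ C) {B : Set E} (hB : MeasurableSet B) :
    posTrace (cutoff μ B (sandwich μ w Q)) =
      ∫⁻ x in B, ENNReal.ofReal (w x) ∂(traceMeasure μ b Q) := by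
  have hi : Measurable (B.indicator (1 : E → ℝ)) := measurable_one.indicator hB
  have hib := ofReal_bound (sqrt_bound (indicator_le_one' B))
  have hwb' := ofReal_bound (sqrt_bound hwb)
  have h1 : ∀ x, B.indicator w x = B.indicator 1 x * w x := fun x => by
    by_cases hx : x ∈ B <;> simp [hx]
  have hs : (fun x => ((√(B.indicator w x) : ℝ) : ℂ)) =
      fun x => ((√(B.indicator 1 x : ℝ) : ℝ) : ℂ) * ((√(w x) : ℝ) : ℂ) := by
    ext x
    rw [h1, Real.sqrt_mul (indicator_nonneg' B x)]
    push_cast; rfl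
  have key : cutoff μ B (sandwich μ w Q) = sandwich μ (B.indicator w) Q := by
    have h2 := mulOp_comp_mulOp (μ := μ) (by fun_prop) hib (by fun_prop) hwb'
    have h3 := mulOp_comp_mulOp (μ := μ) (by fun_prop) hwb' (by fun_prop) hib
    rw [cutoff_eq_sandwich, sandwich, sandwich, sandwich, hs]
    have e2 := fun v => DFunLike.congr_fun h2 v
    have e3 := fun v => DFunLike.congr_fun h3 v
    simp_rw [mul_comm (Complex.ofReal √(w _))] at e3
    ext1 u
    simp only [ContinuousLinearMap.comp_apply] at e2 e3 ⊢
    simp only [e2, e3]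
  have h0 : ∀ x, 0 ≤ B.indicator w x := Set.indicator_nonneg fun x _ => hw0 x
  have hb : ∃ C, ∀ x, B.indicator w x ≤ C := by
    obtain ⟨C, hC⟩ := hwb
    exact ⟨C, fun x => (Set.indicator_le_self' (fun y _ => hw0 y) x).trans (hC x)⟩
  rw [key, posTrace_sandwich b hQ (hw.indicator hB) h0 hb, ← lintegral_indicator hB]
  refine lintegral_congr fun x => ?_
  by_cases hx : x ∈ B <;> simp [hx]

end Multiplication

/-! ### The induced projection: closed range and domination of the intensity -/

section Induced

variable {E : Type*} [MetricSpace E] [MeasurableSpace E] {μ : Measure E} {g : E → ℝ}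
  {Q : Lp ℂ 2 μ →L[ℂ] Lp ℂ 2 μ} {δ : ℝ}

lemma mulOp_sqrt_sqrt_apply (hg_meas : Measurable g) (hg : ∀ x, g x ∈ Set.Icc (0 : ℝ) 1)
    (v : Lp ℂ 2 μ) :
    mulOp μ (fun x => (√(g x) : ℂ)) (mulOp μ (fun x => (√(g x) : ℂ)) v) =
      v - mulOp μ (fun x => ((1 - g x : ℝ) : ℂ)) v := by
  have hb := ofReal_bound (sqrt_bound ⟨1, fun x => (hg x).2⟩)
  have hb1 : ∃ C : ℝ, ∀ x, ‖((1 - g x : ℝ) : ℂ)‖ ≤ C := ofReal_bound ⟨1, fun x => by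
    rw [abs_of_nonneg (by linarith [(hg x).2])]; linarith [(hg x).1]⟩
  apply Lp.ext
  filter_upwards [mulOp_coeFn (by fun_prop) hb (mulOp μ (fun x => (√(g x) : ℂ)) v),
    mulOp_coeFn (by fun_prop) hb v, mulOp_coeFn (by fun_prop) hb1 v,
    Lp.coeFn_sub v (mulOp μ (fun x => ((1 - g x : ℝ) : ℂ)) v)] with x h1 h2 h3 h4
  rw [h1, h2, h4, Pi.sub_apply, h3, ← mul_assoc, ← Complex.ofReal_mul,
    Real.mul_self_sqrt (hg x).1]
  push_cast
  ring

/-- Multiplication by `√g` is bounded below on the range of `Q`. -/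
lemma mul_norm_sq_le_norm_mulOp_sq (hg_meas : Measurable g) (hg : ∀ x, g x ∈ Set.Icc (0 : ℝ) 1)
    (hδ : δ ≤ 1 - ‖mulOp μ (fun x => ((1 - g x : ℝ) : ℂ)) ∘L Q‖) {v : Lp ℂ 2 μ} (hv : Q v = v) :
    δ * ‖v‖ ^ 2 ≤ ‖mulOp μ (fun x => (√(g x) : ℂ)) v‖ ^ 2 := by
  set N := mulOp μ (fun x => ((1 - g x : ℝ) : ℂ)) with hN
  set M := mulOp μ (fun x => (√(g x) : ℂ)) with hM
  have hadj : M.adjoint = M := mulOp_adjoint hg_meas.sqrt (sqrt_bound ⟨1, fun x => (hg x).2⟩)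
  -- √g is self-adjoint with square 1 - (1-g), so the loss of norm is exactly ⟨v, (1-g)v⟩. As v =
  -- Qv, this is at most ‖(1-g)Q‖ ‖v‖² ≤ (1-δ)‖v‖².
  have h1 : ‖M v‖ ^ 2 = ‖v‖ ^ 2 - RCLike.re ⟪v, N v⟫_ℂ := by
    rw [← inner_self_eq_norm_sq (𝕜 := ℂ) (M v), ← ContinuousLinearMap.adjoint_inner_right, hadj,
      mulOp_sqrt_sqrt_apply hg_meas hg, inner_sub_right, map_sub, inner_self_eq_norm_sq]
  have h2 : RCLike.re ⟪v, N v⟫_ℂ ≤ ‖N ∘L Q‖ * ‖v‖ ^ 2 := by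
    calc RCLike.re ⟪v, N v⟫_ℂ ≤ ‖v‖ * ‖N v‖ := re_inner_le_norm _ _
      _ = ‖v‖ * ‖(N ∘L Q) v‖ := by rw [ContinuousLinearMap.comp_apply, hv]
      _ ≤ ‖v‖ * (‖N ∘L Q‖ * ‖v‖) := by gcongr; exact ContinuousLinearMap.le_opNorm _ _
      _ = _ := by ring
  nlinarith [sq_nonneg ‖v‖]

/-- The range of Q is the fixed space of Q, hence complete, and √g is antilipschitz on it with
constant 1/√δ; such a map has closed image. -/
lemma isClosed_inducedSpace (hg_meas : Measurable g) (hg : ∀ x, g x ∈ Set.Icc (0 : ℝ) 1)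
    (hQ : IsStarProjection Q) (hδ0 : 0 < δ)
    (hδ : δ ≤ 1 - ‖mulOp μ (fun x => ((1 - g x : ℝ) : ℂ)) ∘L Q‖) :
    IsClosed (inducedSpace μ g Q : Set (Lp ℂ 2 μ)) := by
  set M := mulOp μ (fun x => (√(g x) : ℂ)) with hM
  have hQQ : ∀ v, Q (Q v) = Q v := fun v => DFunLike.congr_fun hQ.isIdempotentElem.eq v
  have hrange : ∀ v, v ∈ Q.range ↔ Q v = v :=
    fun v => ⟨by rintro ⟨w, rfl⟩; exact hQQ w, fun h => ⟨v, h⟩⟩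
  have hcl : IsClosed (Q.range : Set (Lp ℂ 2 μ)) := by
    have : (Q.range : Set (Lp ℂ 2 μ)) = {v | Q v = v} := Set.ext hrange
    rw [this]
    exact isClosed_eq Q.continuous continuous_id
  have : CompleteSpace Q.range := hcl.completeSpace_coe
  let T : Q.range →L[ℂ] Lp ℂ 2 μ := M ∘L Q.range.subtypeL
  have hanti : AntilipschitzWith (Real.toNNReal (√δ)⁻¹) T := by
    refine T.antilipschitz_of_bound fun v => ?_
    rw [Real.coe_toNNReal _ (by positivity)]
    have h := mul_norm_sq_le_norm_mulOp_sq hg_meas hg hδ ((hrange v).1 v.2)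
    rw [inv_mul_eq_div, le_div_iff₀ (by positivity)]
    refine le_of_sq_le_sq ?_ (norm_nonneg _)
    rw [mul_pow, Real.sq_sqrt hδ0.le, mul_comm]
    exact h
  have hset : (inducedSpace μ g Q : Set (Lp ℂ 2 μ)) = Set.range T := by
    ext u
    simp [inducedSpace, T, hM]
  rw [hset]
  exact hanti.isClosed_range T.uniformContinuous

/-- This is δ Q^g ≤ √g Q √g as quadratic forms. Write p = Q^g u as √g v with v in the range of Q.
Then ‖p‖² = Re⟨√g v, u⟩ = Re⟨v, Q√g u⟩ ≤ ‖v‖ ‖Q√g u‖, while δ‖v‖² ≤ ‖p‖². -/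
lemma mul_norm_inducedProj_sq_le (hg_meas : Measurable g) (hg : ∀ x, g x ∈ Set.Icc (0 : ℝ) 1)
    (hQ : IsStarProjection Q) (hδ0 : 0 < δ)
    (hδ : δ ≤ 1 - ‖mulOp μ (fun x => ((1 - g x : ℝ) : ℂ)) ∘L Q‖) (u : Lp ℂ 2 μ) :
    δ * ‖inducedProj μ g Q u‖ ^ 2 ≤ ‖Q (mulOp μ (fun x => (√(g x) : ℂ)) u)‖ ^ 2 := by
  set M := mulOp μ (fun x => (√(g x) : ℂ)) with hM
  have hadj : M.adjoint = M := mulOp_adjoint hg_meas.sqrt (sqrt_bound ⟨1, fun x => (hg x).2⟩)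
  have hQadj : Q.adjoint = Q := hQ.isSelfAdjoint.star_eq
  -- Closedness is essential here: a point of the closure alone need not have the form √g v.
  have hmem : inducedProj μ g Q u ∈ inducedSpace μ g Q := by
    have h : inducedProj μ g Q u ∈ (inducedSpace μ g Q).topologicalClosure :=
      Submodule.starProjection_apply_mem _ _
    rwa [(isClosed_inducedSpace hg_meas hg hQ hδ0 hδ).submodule_topologicalClosure_eq] at h
  obtain ⟨v, ⟨v', rfl⟩, hv⟩ := hmem
  have hQv : Q (Q v') = Q v' := DFunLike.congr_fun hQ.isIdempotentElem.eq v'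
  have hvp : M (Q v') = inducedProj μ g Q u := hv
  have h1 := mul_norm_sq_le_norm_mulOp_sq hg_meas hg hδ hQv
  rw [← hM, hvp] at h1
  set p := inducedProj μ g Q u with hp
  have h2 : ‖p‖ ^ 2 = RCLike.re ⟪p, u⟫_ℂ := by
    exact (Submodule.re_inner_starProjection_eq_normSq (inducedSpace μ g Q).topologicalClosure u).symm
  have h3 : ‖p‖ ^ 2 ≤ ‖Q v'‖ * ‖Q (M u)‖ := by
    rw [h2, ← hvp, ← ContinuousLinearMap.adjoint_inner_right, hadj, ← hQv,
      ← ContinuousLinearMap.adjoint_inner_right, hQadj, hQv]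
    exact re_inner_le_norm _ _
  rcases eq_or_ne (‖p‖) 0 with h0 | h0
  · rw [h0]; simp
  · have hp2 : 0 < ‖p‖ ^ 2 := by positivity
    refine le_of_mul_le_mul_right ?_ hp2
    calc δ * ‖p‖ ^ 2 * ‖p‖ ^ 2 = δ * (‖p‖ ^ 2) ^ 2 := by ring
      _ ≤ δ * (‖Q v'‖ * ‖Q (M u)‖) ^ 2 := by gcongr
      _ = (δ * ‖Q v'‖ ^ 2) * ‖Q (M u)‖ ^ 2 := by ring
      _ ≤ ‖p‖ ^ 2 * ‖Q (M u)‖ ^ 2 := by gcongr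
      _ = _ := by ring

lemma isStarProjection_inducedProj : IsStarProjection (inducedProj μ g Q) :=
  isStarProjection_starProjection

/-- The intensity of the induced projection is dominated by that of the original one. -/
lemma traceMeasure_inducedProj_le (hg_meas : Measurable g) (hg : ∀ x, g x ∈ Set.Icc (0 : ℝ) 1)
    (hQ : IsStarProjection Q) (hδ0 : 0 < δ)
    (hδ : δ ≤ 1 - ‖mulOp μ (fun x => ((1 - g x : ℝ) : ℂ)) ∘L Q‖)
    {κ : Type*} (b : HilbertBasis κ ℂ (Lp ℂ 2 μ)) :
    traceMeasure μ b (inducedProj μ g Q) ≤ ENNReal.ofReal δ⁻¹ • traceMeasure μ b Q := by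
  refine Measure.le_iff.2 fun A hA => ?_
  have hi : Measurable (A.indicator (1 : E → ℝ)) := measurable_one.indicator hA
  have hib := ofReal_bound (sqrt_bound (indicator_le_one' A))
  have hgb := ofReal_bound (sqrt_bound ⟨1, fun x => (hg x).2⟩)
  have hcomp : mulOp μ (fun x => (√(g x) : ℂ)) ∘L
      mulOp μ (fun x => ((√(A.indicator 1 x : ℝ) : ℝ) : ℂ)) =
        mulOp μ (fun x => (√(g x * A.indicator 1 x) : ℂ)) := by
    rw [mulOp_comp_mulOp (by fun_prop) hgb (by fun_prop) hib]
    congr 1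
    ext x
    rw [Real.sqrt_mul (hg x).1]
    push_cast; rfl
  have hgi : ∀ x, g x * A.indicator 1 x ≤ A.indicator 1 x := fun x =>
    mul_le_of_le_one_left (indicator_nonneg' A x) (hg x).2
  have hpt : ∀ u, ‖inducedProj μ g Q u‖ₑ ^ 2 ≤
      ENNReal.ofReal δ⁻¹ * ‖Q (mulOp μ (fun x => (√(g x) : ℂ)) u)‖ₑ ^ 2 := by
    intro u
    have h := mul_norm_inducedProj_sq_le hg_meas hg hQ hδ0 hδ u
    rw [mul_comm, ← le_div_iff₀ hδ0, div_eq_inv_mul] at h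
    have h' := ENNReal.ofReal_le_ofReal h
    rwa [ENNReal.ofReal_mul (by positivity), ENNReal.ofReal_pow (norm_nonneg _),
      ENNReal.ofReal_pow (norm_nonneg _), ofReal_norm, ofReal_norm] at h'
  have hind : ∀ x, ENNReal.ofReal (A.indicator 1 x) = A.indicator 1 x := fun x => by
    by_cases hx : x ∈ A <;> simp [hx]
  have hmass : ∀ R : Lp ℂ 2 μ →L[ℂ] Lp ℂ 2 μ,
      ∫⁻ x, ENNReal.ofReal (A.indicator 1 x) ∂(traceMeasure μ b R) = traceMeasure μ b R A := by
    intro R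
    simp_rw [hind]
    exact lintegral_indicator_one hA
  rw [← hmass, ← tsum_enorm_comp_mulOp b isStarProjection_inducedProj hi (indicator_nonneg' A)
    (indicator_le_one' A), Measure.smul_apply, smul_eq_mul, ← hmass]
  -- The quadratic form inequality is applied to u = χ_A bₖ and summed over k. The weight that
  -- appears is g χ_A, and g is then dropped using g ≤ 1.
  refine (ENNReal.tsum_le_tsum fun k => hpt _).trans ?_
  rw [ENNReal.tsum_mul_left]
  gcongr
  simp_rw [← ContinuousLinearMap.comp_apply (mulOp μ (fun x => (√(g x) : ℂ))), hcomp]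
  rw [tsum_enorm_comp_mulOp b hQ (w := fun x => g x * A.indicator 1 x) (hg_meas.mul hi)
    (fun x => mul_nonneg (hg x).1 (indicator_nonneg' A x))
    ⟨1, fun x => (hgi x).trans (Set.indicator_le_self' (fun _ _ => zero_le_one) x)⟩]
  exact lintegral_mono fun x => ENNReal.ofReal_le_ofReal (hgi x)

end Induced

/-! ### Exponential trace bound for Fredholm determinants of positive operators -/

section Determinant

variable {H : Type*} [NormedAddCommGroup H] [InnerProductSpace ℂ H] [CompleteSpace H]

/-- An orthonormal family extends to a Hilbert basis, and the trace may be computed in that basis.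
-/
lemma sum_inner_le_posTrace {A : H →L[ℂ] H} (hA : 0 ≤ A) {n : ℕ} {v : Fin n → H}
    (hv : Orthonormal ℂ v) :
    ∑ i, ENNReal.ofReal (RCLike.re ⟪v i, A (v i)⟫_ℂ) ≤ posTrace A := by
  obtain ⟨w, b, hw, hb⟩ := hv.toSubtypeRange.exists_hilbertBasis_extension
  rw [posTrace_eq hA b, ← tsum_fintype (L := .unconditional _)]
  let φ : Fin n → w := fun i => ⟨v i, hw ⟨i, rfl⟩⟩
  have hφ : Function.Injective φ := fun i j h => hv.linearIndependent.injective (by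
    simpa [φ] using h)
  refine le_trans (le_of_eq ?_) (ENNReal.tsum_comp_le_tsum_of_injective hφ _)
  simp [hb, φ]

/-- Diagonalise the positive compression: its determinant is ∏(1 + t lᵢ) ≤ exp(t ∑ lᵢ), and ∑ lᵢ is
a partial trace of A over orthonormal eigenvectors. The bound does not depend on `s`, so it passes
to the limit defining the Fredholm determinant. -/
lemma norm_det_one_add_smul_compress_le {A : H →L[ℂ] H} (hA : 0 ≤ A) (htr : posTrace A < ∞)
    {t : ℝ} (ht : 0 ≤ t) (s : Finset H) :
    ‖(1 + (t : ℂ) • compress A s).det‖ ≤ Real.exp (t * (posTrace A).toReal) := by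
  have hApos := (ContinuousLinearMap.nonneg_iff_isPositive A).1 hA
  set T := (compress A s).toLinearMap with hT
  have hinner : ∀ x y : Submodule.span ℂ (s : Set H), ⟪x, T y⟫_ℂ = ⟪(x : H), A y⟫_ℂ := by
    intro x y
    have hx : (Submodule.span ℂ (s : Set H)).starProjection (x : H) = x :=
      Submodule.starProjection_eq_self_iff.2 x.2
    change ⟪(x : H), (Submodule.span ℂ (s : Set H)).starProjection (A y)⟫_ℂ = _
    rw [← Submodule.inner_starProjection_left_eq_right, hx]
  have hinner' : ∀ x y : Submodule.span ℂ (s : Set H), ⟪T x, y⟫_ℂ = ⟪A x, (y : H)⟫_ℂ := by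
    intro x y
    rw [← inner_conj_symm, hinner, inner_conj_symm]
  have hsym : T.IsSymmetric := fun x y => by
    rw [hinner, hinner']
    exact hApos.isSymmetric _ _
  set n := Module.finrank ℂ (Submodule.span ℂ (s : Set H)) with hn
  set v := hsym.eigenvectorBasis hn.symm with hv
  set l := hsym.eigenvalues hn.symm with hl
  have hlv : ∀ i, l i = RCLike.re ⟪(v i : H), A (v i)⟫_ℂ := by
    intro i
    rw [← hinner, hv, hsym.apply_eigenvectorBasis, inner_smul_right]
    simp [hl]
  have hl0 : ∀ i, 0 ≤ l i := fun i => by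
    rw [hlv]
    exact hApos.re_inner_nonneg_right _
  have hsum : ∑ i, l i ≤ (posTrace A).toReal := by
    have hvo : Orthonormal ℂ fun i => (v i : H) :=
      v.orthonormal.comp_linearIsometry (Submodule.span ℂ (s : Set H)).subtypeₗᵢ
    have h := sum_inner_le_posTrace hA hvo
    simp_rw [← hlv] at h
    rw [← ENNReal.ofReal_sum_of_nonneg fun i _ => hl0 i] at h
    exact (ENNReal.ofReal_le_iff_le_toReal htr.ne).1 h
  have hdet : (1 + (t : ℂ) • compress A s).det = ∏ i, (1 + (t : ℂ) * (l i : ℂ)) := by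
    change LinearMap.det (1 + (t : ℂ) • T) = _
    rw [← LinearMap.det_toMatrix v.toBasis, map_add, map_smul, LinearMap.toMatrix_one,
      hsym.toMatrix_eigenvectorBasis, ← Matrix.diagonal_one, ← Matrix.diagonal_smul,
      Matrix.diagonal_add, Matrix.det_diagonal]
    rfl
  rw [hdet, norm_prod]
  calc ∏ i, ‖1 + (t : ℂ) * (l i : ℂ)‖ ≤ ∏ i, Real.exp (t * l i) := by
        refine Finset.prod_le_prod (fun _ _ => norm_nonneg _) fun i _ => ?_
        have h0 : 0 ≤ t * l i := mul_nonneg ht (hl0 i)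
        rw [← Complex.ofReal_mul, ← Complex.ofReal_one, ← Complex.ofReal_add, Complex.norm_real,
          Real.norm_of_nonneg (by linarith), add_comm]
        exact Real.add_one_le_exp _
    _ = Real.exp (t * ∑ i, l i) := by rw [← Real.exp_sum, Finset.mul_sum]
    _ ≤ _ := by gcongr

lemma norm_le_of_hasFredholmDet {A : H →L[ℂ] H} (hA : 0 ≤ A) (htr : posTrace A < ∞)
    {t : ℝ} (ht : 0 ≤ t) {d : ℂ} (hd : HasFredholmDet ((t : ℂ) • A) d) :
    ‖d‖ ≤ Real.exp (t * (posTrace A).toReal) := by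
  refine le_of_tendsto (Tendsto.norm hd) (Eventually.of_forall fun s => ?_)
  have h : compress ((t : ℂ) • A) s = (t : ℂ) • compress A s := by
    ext x
    simp [compress]
  rw [h]
  exact norm_det_one_add_smul_compress_le hA htr ht s

end Determinant

/-! ### First moments of a determinantal measure -/

section Intensity

variable {E : Type*} [MetricSpace E]

lemma psi_one_add_indicator (X : Conf E) {B : Set E} (hB : Bornology.IsBounded B) (c : ℂ) :
    psi (fun x => 1 + c * B.indicator 1 x) X = (1 + c) ^ count X B := by
  classical
  have hfin := X.finite_inter B hB
  rw [psi, count, finsum_mem_eq_sum _ hfin, ← Finset.prod_pow_eq_pow_sum,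
    finprod_eq_prod_of_mulSupport_subset (s := hfin.toFinset)]
  · refine Finset.prod_congr rfl fun x hx => ?_
    simp only [Set.Finite.mem_toFinset] at hx
    simp [hx.1]
  · intro x hx
    rw [Set.Finite.coe_toFinset]
    by_contra h
    apply hx
    simp only [Set.mem_inter_iff, Function.mem_support, not_and_or, not_not] at h
    rcases h with h | h <;> simp [h]

variable [MeasurableSpace E] {μ : Measure E} {K : Lp ℂ 2 μ →L[ℂ] Lp ℂ 2 μ} {P : Measure (Conf E)}

/-- The test function h = 1 + tχ_B has Ψ_h = (1+t)^{#B}, and (h-1)Kχ_B = tχ_B K χ_B is positive, so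
the exponential trace bound applies. -/
lemma integral_pow_count_le [IsProbabilityMeasure P] (hK : IsStarProjection K)
    (hP : IsDeterminantal μ K P) {B : Set E} (hB : Bornology.IsBounded B) (hBm : MeasurableSet B)
    (htr : posTrace (cutoff μ B K) < ∞) {t : ℝ} (ht : 0 ≤ t) :
    Integrable (fun X => (1 + t) ^ count X B) P ∧
      ∫ X, (1 + t) ^ count X B ∂P ≤ Real.exp (t * (posTrace (cutoff μ B K)).toReal) := by
  have him : Measurable (B.indicator (1 : E → ℂ)) := measurable_one.indicator hBm
  have hbd : ∀ x, ‖(B.indicator 1 x : ℂ)‖ ≤ 1 := fun x => by by_cases hx : x ∈ B <;> simp [hx]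
  obtain ⟨h1, h2⟩ := hP (fun x => 1 + (t : ℂ) * B.indicator 1 x) B (by fun_prop)
    ⟨1 + t * 1, fun x => (norm_add_le _ _).trans (by
      rw [norm_one, norm_mul, Complex.norm_real, Real.norm_of_nonneg ht]
      gcongr
      exact hbd x)⟩ hB hBm (fun x hx => by simp [hx])
  have hop : mulOp μ (fun x => 1 + (t : ℂ) * B.indicator 1 x - 1) ∘L K ∘L
      mulOp μ (B.indicator 1) = (t : ℂ) • cutoff μ B K := by
    simp_rw [add_sub_cancel_left]
    rw [mulOp_const_mul him ⟨1, hbd⟩, cutoff, ContinuousLinearMap.smul_comp]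
  rw [hop] at h2
  have hpsi : psi (fun x => 1 + (t : ℂ) * B.indicator 1 x) =
      fun X => (((1 + t) ^ count X B : ℝ) : ℂ) := by
    ext X
    rw [psi_one_add_indicator X hB]
    push_cast; rfl
  rw [hpsi] at h1 h2
  refine ⟨h1.re, ?_⟩
  rw [integral_complex_ofReal] at h2
  have h3 := norm_le_of_hasFredholmDet (cutoff_nonneg hK hBm) htr ht h2
  rw [Complex.norm_real] at h3
  exact (le_abs_self _).trans h3

/-- The mean number of particles in a bounded set is at most the trace. -/
lemma lintegral_count_le [IsProbabilityMeasure P] (hK : IsStarProjection K)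
    (hP : IsDeterminantal μ K P) {B : Set E} (hB : Bornology.IsBounded B)
    (hBm : MeasurableSet B) :
    ∫⁻ X, (count X B : ℝ≥0∞) ∂P ≤ posTrace (cutoff μ B K) := by
  rcases eq_top_or_lt_top (posTrace (cutoff μ B K)) with htop | htr
  · rw [htop]; exact le_top
  set τ := (posTrace (cutoff μ B K)).toReal with hτ
  -- Bernoulli's inequality gives n ≤ ((1+t)ⁿ - 1)/t. The right-hand side below is the difference
  -- quotient at 0 of exp(tτ), which tends to τ as t ↓ 0.
  have hbound : ∀ t : ℝ, 0 < t → ∫⁻ X, (count X B : ℝ≥0∞) ∂P ≤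
      ENNReal.ofReal (t⁻¹ * (Real.exp (t * τ) - 1)) := by
    intro t ht
    obtain ⟨h1, h2⟩ := integral_pow_count_le hK hP hB hBm htr ht.le
    have hpt : ∀ X : Conf E, (count X B : ℝ) ≤ t⁻¹ * ((1 + t) ^ count X B - 1) := by
      intro X
      rw [inv_mul_eq_div, le_div_iff₀ ht]
      linarith [one_add_mul_le_pow (show (-2 : ℝ) ≤ t by linarith) (count X B)]
    have hint : Integrable (fun X => t⁻¹ * ((1 + t) ^ count X B - 1)) P :=
      (h1.sub (integrable_const 1)).const_mul _
    calc ∫⁻ X, (count X B : ℝ≥0∞) ∂P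
        ≤ ∫⁻ X, ENNReal.ofReal (t⁻¹ * ((1 + t) ^ count X B - 1)) ∂P := by
          refine lintegral_mono fun X => ?_
          rw [← ENNReal.ofReal_natCast]
          exact ENNReal.ofReal_le_ofReal (hpt X)
      _ = ENNReal.ofReal (∫ X, t⁻¹ * ((1 + t) ^ count X B - 1) ∂P) :=
          (ofReal_integral_eq_lintegral_ofReal hint (ae_of_all _ fun X =>
            (Nat.cast_nonneg _).trans (hpt X))).symm
      _ ≤ _ := by
          refine ENNReal.ofReal_le_ofReal ?_
          rw [integral_const_mul, integral_sub h1 (integrable_const 1)]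
          simp only [integral_const, probReal_univ, smul_eq_mul, mul_one]
          gcongr
  have hder : HasDerivAt (fun t : ℝ => Real.exp (t * τ)) τ 0 := by
    simpa using ((hasDerivAt_id (0 : ℝ)).mul_const τ).exp
  have hlim := hder.tendsto_slope_zero_right
  simp only [zero_add, zero_mul, Real.exp_zero, smul_eq_mul] at hlim
  have hlim' := ENNReal.tendsto_ofReal hlim
  rw [hτ, ENNReal.ofReal_toReal htr.ne] at hlim'
  refine ge_of_tendsto hlim' ?_
  filter_upwards [self_mem_nhdsWithin] with t ht
  exact hbound t ht

variable [BorelSpace E]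

/-- The left side is the intensity measure of P. Counts are controlled only on bounded sets, so A is
exhausted by its intersections with balls. -/
lemma bind_sigmaMeasure_one_le [IsProbabilityMeasure P] (hK : IsStarProjection K)
    (hP : IsDeterminantal μ K P) {κ : Type*} (b : HilbertBasis κ ℂ (Lp ℂ 2 μ)) :
    P.bind (sigmaMeasure fun _ => 1) ≤ traceMeasure μ b K := by
  refine Measure.le_iff.2 fun A hA => ?_
  rcases isEmpty_or_nonempty E with hE | ⟨⟨x₀⟩⟩
  · simp [Set.eq_empty_of_isEmpty A]
  have hmono : Monotone fun n : ℕ => A ∩ Metric.closedBall x₀ (n : ℝ) := fun n m hnm =>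
    Set.inter_subset_inter_right _ (Metric.closedBall_subset_closedBall (by exact_mod_cast hnm))
  have hU : A = ⋃ n : ℕ, A ∩ Metric.closedBall x₀ (n : ℝ) := by
    rw [← Set.inter_iUnion, Metric.iUnion_closedBall_nat, Set.inter_univ]
  rw [hU, hmono.measure_iUnion, hmono.measure_iUnion]
  refine iSup_mono fun n => ?_
  have hbd : Bornology.IsBounded (A ∩ Metric.closedBall x₀ (n : ℝ)) :=
    Metric.isBounded_closedBall.subset Set.inter_subset_right
  have hm : MeasurableSet (A ∩ Metric.closedBall x₀ (n : ℝ)) :=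
    hA.inter Metric.isClosed_closedBall.measurableSet
  rw [Measure.bind_apply hm measurable_sigmaMeasure_one.aemeasurable, ← posTrace_cutoff b hK hm]
  simp_rw [sigmaMeasure_one_apply _ hbd hm]
  exact lintegral_count_le hK hP hbd hm

/-- One half of Campbell's formula: the sum over X is the integral of F against the counting measure
of X, and averaging over P integrates F against the intensity. -/
lemma lintegral_tsum_mult_le [IsProbabilityMeasure P] (hK : IsStarProjection K)
    (hP : IsDeterminantal μ K P) {κ : Type*} (b : HilbertBasis κ ℂ (Lp ℂ 2 μ)) {F : E → ℝ≥0∞}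
    (hF : Measurable F) :
    ∫⁻ X, ∑' x, (X.mult x : ℝ≥0∞) * F x ∂P ≤ ∫⁻ x, F x ∂(traceMeasure μ b K) := by
  simp_rw [← lintegral_sigmaMeasure_one _ hF]
  rw [← Measure.lintegral_bind measurable_sigmaMeasure_one.aemeasurable hF.aemeasurable]
  exact lintegral_mono' (bind_sigmaMeasure_one_le hK hP b) le_rfl

end Intensity

/-! ### Tightness of random finite measures -/

section Compactness

variable {E : Type*} [MetricSpace E] [MeasurableSpace E] [BorelSpace E]

/-- A weight function growing to infinity outside of the sets `K j`. -/
def complWeight (K : ℕ → Set E) (x : E) : ℝ≥0∞ := 1 + ∑' j, 2 ^ j * (K j)ᶜ.indicator 1 x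

lemma measurable_complWeight {K : ℕ → Set E} (hK : ∀ j, MeasurableSet (K j)) :
    Measurable (complWeight K) := by
  have h : ∀ j : ℕ, Measurable fun x => (2 : ℝ≥0∞) ^ j * (K j)ᶜ.indicator 1 x := fun j =>
    (measurable_one.indicator (hK j).compl).const_mul _
  exact (Measurable.tsum h).const_add 1

lemma lintegral_complWeight {K : ℕ → Set E} (hK : ∀ j, MeasurableSet (K j)) (η : Measure E) :
    ∫⁻ x, complWeight K x ∂η = η Set.univ + ∑' j, 2 ^ j * η (K j)ᶜ := by
  have hm : ∀ j, Measurable ((K j)ᶜ.indicator (1 : E → ℝ≥0∞)) := fun j =>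
    measurable_one.indicator (hK j).compl
  simp only [complWeight]
  rw [lintegral_add_left measurable_const, lintegral_const, one_mul,
    lintegral_tsum fun j => ((hm j).const_mul _).aemeasurable]
  congr 1
  refine tsum_congr fun j => ?_
  rw [lintegral_const_mul _ (hm j), lintegral_indicator_one (hK j).compl]

lemma measurable_tsum_mult {F : E → ℝ≥0∞} (hF : Measurable F) :
    Measurable fun X : Conf E => ∑' x, (X.mult x : ℝ≥0∞) * F x := by
  have := (Measure.measurable_lintegral hF).comp (measurable_sigmaMeasure_one (E := E))
  simpa only [Function.comp_def, lintegral_sigmaMeasure_one _ hF] using this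

/-- An inequality suffices and holds for every X, since `sigma` takes the value 0 outside Conf_f. -/
lemma lintegral_sigma_le (f : E → ℝ) (X : Conf E) {F : E → ℝ≥0∞} (hF : Measurable F) :
    ∫⁻ x, F x ∂(sigma f X : Measure E) ≤
      ∑' x, (X.mult x : ℝ≥0∞) * (ENNReal.ofReal (f x) * F x) := by
  by_cases hX : X ∈ confF f
  · have h : (sigma f X : Measure E) = sigmaMeasure f X := by simp [sigma, hX]
    rw [h, sigmaMeasure, lintegral_sum_measure]
    refine (tsum_congr fun x => ?_).le
    rw [lintegral_smul_measure, lintegral_dirac' x hF, smul_eq_mul, mul_assoc]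
  · have h : (sigma f X : Measure E) = 0 := by simp [sigma, hX]
    simp [h]

/-- Prokhorov's criterion is used twice: on E it makes the sets `S n` compact, and on the space of
finite measures it uses the `S n` as the compact sets that carry almost all mass. -/
lemma isCompact_closure_range_pushSigma [ProperSpace E] {ι : Type*} {f : E → ℝ}
    (hf : Measurable f) {K : ℕ → Set E} (hK : ∀ j, IsCompact (K j)) {C : ℝ≥0}
    (P : ι → Measure (Conf E)) [∀ α, IsProbabilityMeasure (P α)]
    (hC : ∀ α, ∫⁻ X, ∑' x, (X.mult x : ℝ≥0∞) * (ENNReal.ofReal (f x) * complWeight K x) ∂(P α) ≤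
      C) :
    IsCompact (closure (Set.range fun α => pushSigma f (P α))) := by
  have hKm : ∀ j, MeasurableSet (K j) := fun j => (hK j).measurableSet
  have hw := measurable_complWeight hKm
  have hgeo : Tendsto (fun j : ℕ => (2⁻¹ : ℝ≥0) ^ j) atTop (𝓝 0) :=
    NNReal.tendsto_pow_atTop_nhds_zero_of_lt_one (by
      rw [← NNReal.coe_lt_coe]; push_cast; norm_num)
  -- These bounds are what ∫ w dη < 2ⁿ forces for w = `complWeight K`, since that integral dominates
  -- both the mass and each 2ʲ η((K j)ᶜ).
  let S : ℕ → Set (FiniteMeasure E) := fun n =>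
    {η | η.mass ≤ 2 ^ n ∧ ∀ j, η (K j)ᶜ ≤ 2 ^ n * 2⁻¹ ^ j}
  have hS : ∀ n, IsCompact (S n) := fun n =>
    isCompact_setOfPred_finiteMeasure_mass_le_compl_isCompact_le _
      (by simpa using hgeo.const_mul (2 ^ n)) hK (Or.inl inferInstance)
  have hSmono : Monotone S := by
    intro n m hnm η hη
    have h2 : (2 : ℝ≥0) ^ n ≤ 2 ^ m := pow_le_pow_right₀ one_le_two hnm
    exact ⟨hη.1.trans h2, fun j => (hη.2 j).trans (by gcongr)⟩
  have hsub : ∀ n, (S n)ᶜ ⊆ {η | (2 : ℝ≥0∞) ^ n ≤ ∫⁻ x, complWeight K x ∂(η : Measure E)} := by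
    intro n η hη
    by_contra hlt
    refine hη ?_
    simp only [Set.mem_ofPred_eq, not_le] at hlt
    rw [lintegral_complWeight hKm] at hlt
    refine ⟨?_, fun j => ?_⟩
    · rw [← ENNReal.coe_le_coe, FiniteMeasure.ennreal_mass]
      push_cast
      exact le_self_add.trans hlt.le
    · rw [← ENNReal.coe_le_coe, FiniteMeasure.ennreal_coeFn_eq_coeFn_toMeasure]
      have h1 : 2 ^ j * (η : Measure E) (K j)ᶜ ≤ 2 ^ n :=
        ((ENNReal.le_tsum j).trans le_add_self).trans hlt.le
      rw [mul_comm, ← ENNReal.le_div_iff_mul_le (by simp) (by simp)] at h1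
      refine h1.trans_eq ?_
      rw [div_eq_mul_inv, ENNReal.coe_mul, ENNReal.coe_pow, ENNReal.coe_pow,
        ENNReal.coe_inv two_ne_zero, ENNReal.inv_pow]
      rfl
  -- The push-forwards have mass 1, and Markov's inequality at level 2ⁿ for an integral of mean at
  -- most C gives the tail C·2⁻ⁿ.
  have hT : IsCompact {ν : FiniteMeasure (FiniteMeasure E) |
      ν.mass ≤ 1 ∧ ∀ n, ν (S n)ᶜ ≤ C * 2⁻¹ ^ n} :=
    isCompact_setOfPred_finiteMeasure_mass_le_compl_isCompact_le _
      (by simpa using hgeo.const_mul C) hS (Or.inr hSmono)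
  refine hT.closure_of_subset ?_
  rintro _ ⟨α, rfl⟩
  have hmap : ((pushSigma f (P α) : FiniteMeasure (FiniteMeasure E)) :
      Measure (FiniteMeasure E)) = (P α).map (sigma f) := rfl
  have hW : Measurable fun η : FiniteMeasure E => ∫⁻ x, complWeight K x ∂(η : Measure E) :=
    (Measure.measurable_lintegral hw).comp measurable_subtype_coe
  refine ⟨?_, fun n => ?_⟩
  · rw [← ENNReal.coe_le_coe, FiniteMeasure.ennreal_mass, hmap,
      Measure.map_apply (measurable_sigma hf) MeasurableSet.univ]
    simp
  · rw [← ENNReal.coe_le_coe, FiniteMeasure.ennreal_coeFn_eq_coeFn_toMeasure, hmap]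
    refine (measure_mono (hsub n)).trans ?_
    have h1 := mul_meas_ge_le_lintegral₀ (μ := (P α).map (sigma f)) hW.aemeasurable (2 ^ n)
    rw [lintegral_map hW (measurable_sigma hf)] at h1
    have h2 := h1.trans ((lintegral_mono fun X => lintegral_sigma_le f X hw).trans (hC α))
    rw [mul_comm, ← ENNReal.le_div_iff_mul_le (by simp) (by simp)] at h2
    refine h2.trans_eq ?_
    rw [div_eq_mul_inv, ENNReal.coe_mul, ENNReal.coe_pow, ENNReal.coe_inv two_ne_zero,
      ENNReal.inv_pow]
    rfl

end Compactness

end DetProc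

end

/-! ### Proof of the proposition -/

theorem proposition3p8 {E : Type*} [MetricSpace E] [ProperSpace E] [MeasurableSpace E]
    [BorelSpace E] (μ : Measure E) [SigmaFinite μ] {ι : Type*}
    (f : E → ℝ) (hf_cont : Continuous f) (hf_nonneg : ∀ x, 0 ≤ f x) (hf_bdd : ∃ C, ∀ x, f x ≤ C)
    (g : E → ℝ) (hg_meas : Measurable g) (hg : ∀ x, g x ∈ Set.Icc (0 : ℝ) 1)
    (Q : ι → Lp ℂ 2 μ →L[ℂ] Lp ℂ 2 μ)
    (hQ_proj : ∀ α, IsStarProjection (Q α))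
    (hQ_loc : ∀ α, DetProc.IsLocTraceClass μ (Q α))
    (hQ_sup : ⨆ α, DetProc.posTrace (DetProc.sandwich μ f (Q α)) < ∞)
    (hQ_tight : ∀ ε : ℝ, 0 < ε → ∃ B : Set E, Bornology.IsBounded B ∧ MeasurableSet B ∧
      ⨆ α, DetProc.posTrace (DetProc.cutoff μ Bᶜ (DetProc.sandwich μ f (Q α))) < ENNReal.ofReal ε)
    (hQ_ind : ∀ α, DetProc.IsTraceClass (DetProc.sandwich μ (fun x => 1 - g x) (Q α)))
    (hQ_lt : ∀ α, ‖DetProc.mulOp μ (fun x => ((1 - g x : ℝ) : ℂ)) ∘L Q α‖ < 1)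
    (hQ_inf : ∃ δ : ℝ, 0 < δ ∧
      ∀ α, δ ≤ 1 - ‖DetProc.mulOp μ (fun x => ((1 - g x : ℝ) : ℂ)) ∘L Q α‖)
    (P : ι → Measure (DetProc.Conf E)) [∀ α, IsProbabilityMeasure (P α)]
    (hP : ∀ α, DetProc.IsDeterminantal μ (DetProc.inducedProj μ g (Q α)) (P α)) :
    (∀ α, IsClosed (DetProc.inducedSpace μ g (Q α) : Set (Lp ℂ 2 μ))) ∧
    (∀ α, DetProc.IsLocTraceClass μ (DetProc.inducedProj μ g (Q α))) ∧
    (∀ α, ∀ᵐ X ∂(P α), X ∈ DetProc.confF f) ∧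
    IsCompact (closure (Set.range fun α => DetProc.pushSigma f (P α))) := by

  obtain ⟨δ, hδ0, hδ⟩ := hQ_inf
  obtain ⟨_, b, -⟩ := exists_hilbertBasis ℂ (Lp ℂ 2 μ)
  have hf_meas : Measurable f := hf_cont.measurable
  have hF : Measurable fun x => ENNReal.ofReal (f x) := hf_meas.ennreal_ofReal
  have hdom : ∀ α, DetProc.traceMeasure μ b (DetProc.inducedProj μ g (Q α)) ≤
      ENNReal.ofReal δ⁻¹ • DetProc.traceMeasure μ b (Q α) := fun α =>
    DetProc.traceMeasure_inducedProj_le hg_meas hg (hQ_proj α) hδ0 (hδ α) b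
  have hmean : ∀ α (F : E → ℝ≥0∞), Measurable F →
      ∫⁻ X, ∑' x, (X.mult x : ℝ≥0∞) * F x ∂(P α) ≤
        ENNReal.ofReal δ⁻¹ * ∫⁻ x, F x ∂(DetProc.traceMeasure μ b (Q α)) := by
    intro α F hF
    refine (DetProc.lintegral_tsum_mult_le DetProc.isStarProjection_inducedProj
      (hP α) b hF).trans ?_
    rw [← smul_eq_mul, ← lintegral_smul_measure]
    exact lintegral_mono' (hdom α) le_rfl
  set s := ⨆ α, DetProc.posTrace (DetProc.sandwich μ f (Q α)) with hs
  have htr : ∀ α, ∫⁻ x, ENNReal.ofReal (f x) ∂(DetProc.traceMeasure μ b (Q α)) ≤ s := by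
    intro α
    rw [← DetProc.posTrace_sandwich b (hQ_proj α) hf_meas hf_nonneg hf_bdd]
    exact le_iSup (fun α => DetProc.posTrace (DetProc.sandwich μ f (Q α))) α
  refine ⟨fun α => DetProc.isClosed_inducedSpace hg_meas hg (hQ_proj α) hδ0 (hδ α), ?_, ?_, ?_⟩
  · intro α B hB hBm
    have h := hQ_loc α B hB hBm
    rw [DetProc.isTraceClass_iff_of_nonneg (DetProc.cutoff_nonneg (hQ_proj α) hBm),
      DetProc.posTrace_cutoff b (hQ_proj α) hBm] at h
    rw [DetProc.isTraceClass_iff_of_nonneg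
      (DetProc.cutoff_nonneg DetProc.isStarProjection_inducedProj hBm),
      DetProc.posTrace_cutoff b DetProc.isStarProjection_inducedProj hBm]
    exact (hdom α B).trans_lt (ENNReal.mul_lt_top ENNReal.ofReal_lt_top h)
  · intro α
    -- The sum ∑ f(x) has finite mean, hence is finite almost surely.
    refine ae_lt_top (DetProc.measurable_tsum_mult hF) (ne_of_lt ?_)
    exact (hmean α _ hF).trans_lt
      (ENNReal.mul_lt_top ENNReal.ofReal_lt_top ((htr α).trans_lt hQ_sup))
  · choose B hB hBm hBt using fun j : ℕ => hQ_tight ((4⁻¹ : ℝ) ^ j) (by positivity)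
    -- Closures of bounded sets are compact in a proper space, and enlarging B to its closure only
    -- shrinks the tail.
    have hK : ∀ j, IsCompact (closure (B j)) := fun j => (hB j).isCompact_closure
    have hKm : ∀ j, MeasurableSet (closure (B j)) := fun j => isClosed_closure.measurableSet
    have htail : ∀ α j, ∫⁻ x in (closure (B j))ᶜ, ENNReal.ofReal (f x)
        ∂(DetProc.traceMeasure μ b (Q α)) ≤ ENNReal.ofReal ((4⁻¹ : ℝ) ^ j) := by
      intro α j
      refine (lintegral_mono_set (Set.compl_subset_compl.2 subset_closure)).trans ?_
      rw [← DetProc.posTrace_cutoff_sandwich b (hQ_proj α) hf_meas hf_nonneg hf_bdd (hBm j).compl]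
      exact (le_iSup (fun α => DetProc.posTrace (DetProc.cutoff μ (B j)ᶜ
        (DetProc.sandwich μ f (Q α)))) α).trans (hBt j).le
    have hsum : ∑' j : ℕ, (2 : ℝ≥0∞) ^ j * ENNReal.ofReal ((4⁻¹ : ℝ) ^ j) < ∞ := by
      have h : ∀ j : ℕ, (2 : ℝ≥0∞) ^ j * ENNReal.ofReal ((4⁻¹ : ℝ) ^ j) =
          ENNReal.ofReal ((1 / 2 : ℝ) ^ j) := by
        intro j
        rw [← ENNReal.ofReal_ofNat 2, ← ENNReal.ofReal_pow (by norm_num),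
          ← ENNReal.ofReal_mul (by positivity), ← mul_pow]
        norm_num
      simp_rw [h]
      rw [← ENNReal.ofReal_tsum_of_nonneg (fun j => by positivity) summable_geometric_two]
      exact ENNReal.ofReal_lt_top
    set C := ENNReal.ofReal δ⁻¹ *
      (s + ∑' j : ℕ, (2 : ℝ≥0∞) ^ j * ENNReal.ofReal ((4⁻¹ : ℝ) ^ j)) with hC
    have hCfin : C ≠ ∞ :=
      (ENNReal.mul_lt_top ENNReal.ofReal_lt_top (ENNReal.add_lt_top.2 ⟨hQ_sup, hsum⟩)).ne
    refine DetProc.isCompact_closure_range_pushSigma hf_meas hK (C := C.toNNReal) P fun α => ?_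
    rw [ENNReal.coe_toNNReal hCfin]
    refine (hmean α _ (hF.mul (DetProc.measurable_complWeight hKm))).trans ?_
    rw [hC]
    gcongr
    -- Absorbing f into the measure turns ∫ f w into the total f-mass, at most s, plus ∑ 2ʲ times
    -- the f-mass outside the closure of B j.
    have h := lintegral_withDensity_eq_lintegral_mul (DetProc.traceMeasure μ b (Q α)) hF
      (DetProc.measurable_complWeight hKm)
    rw [← h, DetProc.lintegral_complWeight hKm, withDensity_apply _ MeasurableSet.univ,
      Measure.restrict_univ]
    refine add_le_add (htr α) (ENNReal.tsum_le_tsum fun j => ?_)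
    rw [withDensity_apply _ (hKm j).compl]
    gcongr
    exact htail α j
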